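/- Let $0\le k\le n$ be integers. \emph{The algebra.} Let $V(n,k)$ be the set of $k$-element subsets $x=\{x_1<\dots<x_k\}$ of $\{0,\dots,n\}$, and $V_l(n,k)\subset V(n,k)$ the set of those not containing $n$. For $x\in V(n,k)$ and $1\le i\le n$ put $v_i^x=|x\cap\{i,\dots,n\}|$, $w_i^{x,y}=\tfrac12|v_i^x-v_i^y|$ and $g_i^{x,y,z}=w_i^{y,z}-w_i^{x,z}+w_i^{x,y}\in\mathbb Z_{\ge0}$. Let $\mathcal B_0(n,k)$ be the path algebra over $\mathbb Z[U_1,\dots,U_n]$ of the quiver with vertex set $V(n,k)$ and a unique arrow $f_{x,y}$ from $x$ to $y$ for all $x,y$ (the trivial path at $x$ being $\mathbf I_x=f_{x,x}$; paths are multiplied from left to right), modulo the relations $f_{x,y}f_{y,z}=\prod_{i=1}^nU_i^{g_i^{x,y,z}}f_{x,z}$. Put $R_i=\sum f_{x,(x\setminus\{i-1\})\cup\{i\}}$, summed over $x$ with $x\cap\{i-1,i\}=\{i-1\}$, and $L_i=\sum f_{x,(x\setminus\{i\})\cup\{i-1\}}$, summed over $x$ with $x\cap\{i-1,i\}=\{i\}$.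 Let $\mathcal B(n,k)$ be the quotient of $\mathcal B_0(n,k)$ by the two-sided ideal generated by $R_{i-1}R_i$ and $L_iL_{i-1}$ for $2\le i\le n$, and by $U_i\mathbf I_x$ for $1\le i\le n$ and $x\cap\{i-1,i\}=\varnothing$. Let $\mathcal B_l(n,k)=e\,\mathcal B(n,k)\,e$ with $e=\sum_{x\in V_l(n,k)}\mathbf I_x$. Let $S=\mathbb Z[\varepsilon_1,\dots,\varepsilon_k]$ act on $\mathcal B_l(n,k)$ with $\varepsilon_i$ acting as the elementary symmetric polynomial $e_i(U_1,\dots,U_n)$. \emph{Fork elements.} Call $x,y\in V(n,k)$ too far if $|x_i-y_i|>1$ for some $i$, and write $x\preceq z$ (equivalently $z\succeq x$) if $z_i\le x_i$ for all $i$. Let $h_1^x<\dots<h_{n-k+1}^x$ be the elements of $\{0,\dots,n\}\setminus x$. For $x,y\in V_l(n,k)$ not too far, an interval $[j+1,j+l]\subset[1,n]$ with $l\ge1$ is a generating interval for $x,y$ if $j,\,j+l\notin x\cap y$, if $j+1,\dots,j+l-1\in x\cap y$, and if $v_m^x=v_m^y$ for $j+1\le m\le j+l$; there are $n-k$ of them,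 written $[j_i+1,j_i+l_i]$, $1\le i\le n-k$, in increasing order. For $\sigma\in S_k$ let $\mathfrak S'_\sigma(t_1,\dots,t_k)=\prod_{i=1}^kt_i^{c_i}$ with $c_i=\#\{j<\sigma^{-1}(i):\sigma(j)>i\}$. For $x,y,z\in V_l(n,k)$, no two of which are too far, with $x\preceq z\succeq y$, and $\sigma\in S_k$, define $$\mathsf p_{(x,z^\sigma,y)}=\mathfrak S'_\sigma(U_{z_1+1},\dots,U_{z_k+1})\prod_{i=1}^{n-k}U_{j_i+1}U_{j_i+2}\cdots U_{h_i^z}\in\mathbb Z[U_1,\dots,U_n].$$ \textbf{Theorem.} $\mathcal B_l(n,k)$ is a free $S$-module, and the elements $\mathsf p_{(x,z^\sigma,y)}f_{x,y}$, indexed by all $(x,y,z,\sigma)$ with $x,y,z\in V_l(n,k)$ pairwise not too far, $x\preceq z\succeq y$, and $\sigma\in S_k$, form an $S$-basis. -/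

import Mathlib

namespace OzsvathSzabo

noncomputable section

/-! ### I-states -/

/-- The set `V(n,k)` of I-states: subsets of `{0, …, n}` with `k` elements. -/
abbrev V (n k : ℕ) : Type := ↥(Finset.powersetCard k (Finset.range (n + 1)))

/-- The set `V_l(n,k)` of left I-states: subsets of `{0, …, n - 1}` with `k` elements. -/
abbrev Vl (n k : ℕ) : Type := ↥(Finset.powersetCard k (Finset.range n))

/-- The inclusion of left I-states into I-states. -/
def Vl.toV {n k : ℕ} (x : Vl n k) : V n k :=
  ⟨x.1, Finset.powersetCard_mono (Finset.range_mono (Nat.le_succ n)) x.2⟩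

/-- The `i`-th smallest element of a finite set of natural numbers, counting from `i = 0`.
It is only used for `i` less than the number of elements. -/
def nthElem (s : Finset ℕ) (i : ℕ) : ℕ := Nat.nth (fun a => a ∈ s) i

/-- The hole sequence of `x ⊆ {0, …, n}`: the elements of `{0, …, n} \ x` in increasing order,
counting from `i = 0`. -/
def hole (n : ℕ) (x : Finset ℕ) (i : ℕ) : ℕ := nthElem (Finset.range (n + 1) \ x) i

/-- The weight `v_i^x = |x ∩ {i, i + 1, …}|`. -/
def weight (x : Finset ℕ) (i : ℕ) : ℕ := (x.filter (fun a => i ≤ a)).card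

/-- Twice the number `w_i^{x,y}`, that is, `|v_i^x - v_i^y|`. -/
def twoW (x y : Finset ℕ) (i : ℕ) : ℤ := |(weight x i : ℤ) - (weight y i : ℤ)|

/-- The exponent `g_i^{x,y,z} = w_i^{y,z} - w_i^{x,z} + w_i^{x,y}`, a natural number by
`two_mul_gExp`. -/
def gExp (x y z : Finset ℕ) (i : ℕ) : ℕ :=
  ((twoW y z i - twoW x z i + twoW x y i) / 2).toNat

theorem two_mul_gExp (x y z : Finset ℕ) (i : ℕ) :
    2 * (gExp x y z i : ℤ) = twoW y z i - twoW x z i + twoW x y i := by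
  unfold gExp twoW
  generalize (weight x i : ℤ) = a
  generalize (weight y i : ℤ) = b
  generalize (weight z i : ℤ) = c
  rcases abs_cases (b - c) with ⟨h1, _⟩ | ⟨h1, _⟩ <;>
  rcases abs_cases (a - c) with ⟨h2, _⟩ | ⟨h2, _⟩ <;>
  rcases abs_cases (a - b) with ⟨h3, _⟩ | ⟨h3, _⟩ <;>
  rw [h1, h2, h3] <;> omega

/-! ### The big-step algebra -/

/-- The polynomial ring `ℤ[U_1, …, U_n]`; the variable `U_{t + 1}` is `X t` for `t : Fin n`. -/
abbrev PolyU (n : ℕ) : Type := MvPolynomial (Fin n) ℤ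

/-- The monomial `∏_i U_i ^ {g_i^{x,y,z}}`. -/
def gMonomial (n : ℕ) (x y z : Finset ℕ) : PolyU n :=
  ∏ t : Fin n, MvPolynomial.X t ^ gExp x y z (t.1 + 1)

/-- The free algebra on the arrows `x → y`, one for each pair of I-states. -/
abbrev ArrowAlg (n k : ℕ) : Type := FreeAlgebra (PolyU n) (V n k × V n k)

/-- The arrow from `x` to `y`. -/
def arrow {n k : ℕ} (x y : V n k) : ArrowAlg n k := FreeAlgebra.ι (PolyU n) (x, y)

/-- The relations of the path algebra of the quiver with a unique arrow `f_{x,y}` between any two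
I-states (the trivial path at `x` being `f_{x,x}`), together with
`f_{x,y} f_{y,z} = ∏_i U_i ^ {g_i^{x,y,z}} f_{x,z}`. -/
inductive B0Rel (n k : ℕ) : ArrowAlg n k → ArrowAlg n k → Prop
  | one : B0Rel n k (∑ x : V n k, arrow x x) 1
  | not_composable (x y z w : V n k) (h : y ≠ z) : B0Rel n k (arrow x y * arrow z w) 0
  | comp (x y z : V n k) :
      B0Rel n k (arrow x y * arrow y z) (gMonomial n x.1 y.1 z.1 • arrow x z)

/-- The algebra `B_0(n,k)` over `ℤ[U_1, …, U_n]`. -/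
def B0 (n k : ℕ) : Type := RingQuot (B0Rel n k)

instance (n k : ℕ) : Semiring (B0 n k) := inferInstanceAs (Semiring (RingQuot (B0Rel n k)))

instance (n k : ℕ) : Algebra (PolyU n) (B0 n k) :=
  inferInstanceAs (Algebra (PolyU n) (RingQuot (B0Rel n k)))

instance (n k : ℕ) : Ring (B0 n k) := Algebra.semiringToRing (PolyU n)

/-- The quotient map onto `B_0(n,k)`. -/
def mkB0 (n k : ℕ) : ArrowAlg n k →ₐ[PolyU n] B0 n k := RingQuot.mkAlgHom (PolyU n) (B0Rel n k)

/-- The element `f_{x,y}` of `B_0(n,k)`. -/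
def f0 {n k : ℕ} (x y : V n k) : B0 n k := mkB0 n k (arrow x y)

open Classical in
/-- The element `R_{t + 1}`: the sum of the `f_{x,y}` with `x ∩ {t, t + 1} = {t}` and
`y = (x \ {t}) ∪ {t + 1}`. -/
def elemR (n k t : ℕ) : B0 n k :=
  ∑ x : V n k, ∑ y : V n k,
    if x.1 ∩ {t, t + 1} = {t} ∧ y.1 = (x.1 \ {t}) ∪ {t + 1} then f0 x y else 0

open Classical in
/-- The element `L_{t + 1}`: the sum of the `f_{x,y}` with `x ∩ {t, t + 1} = {t + 1}` and
`y = (x \ {t + 1}) ∪ {t}`. -/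
def elemL (n k t : ℕ) : B0 n k :=
  ∑ x : V n k, ∑ y : V n k,
    if x.1 ∩ {t, t + 1} = {t + 1} ∧ y.1 = (x.1 \ {t + 1}) ∪ {t} then f0 x y else 0

/-- The relations imposed on `B_0(n,k)`: `R_{i - 1} R_i = 0` and `L_i L_{i - 1} = 0` (here
`i = t + 2` runs from `2` to `n`), and `U_i I_x = 0` if `x ∩ {i - 1, i} = ∅` (here `i = t + 1`
runs from `1` to `n`). -/
inductive BRel (n k : ℕ) : B0 n k → B0 n k → Prop
  | RR (t : ℕ) (ht : t + 2 ≤ n) : BRel n k (elemR n k t * elemR n k (t + 1)) 0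
  | LL (t : ℕ) (ht : t + 2 ≤ n) : BRel n k (elemL n k (t + 1) * elemL n k t) 0
  | U (t : Fin n) (x : V n k) (h : x.1 ∩ {t.1, t.1 + 1} = ∅) :
      BRel n k ((MvPolynomial.X t : PolyU n) • f0 x x) 0

/-- The algebra `B(n,k)` over `ℤ[U_1, …, U_n]`: the quotient of `B_0(n,k)` by the two-sided ideal
generated by the above elements. -/
def B (n k : ℕ) : Type := RingQuot (BRel n k)

instance (n k : ℕ) : Semiring (B n k) := inferInstanceAs (Semiring (RingQuot (BRel n k)))

instance (n k : ℕ) : Algebra (PolyU n) (B n k) :=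
  inferInstanceAs (Algebra (PolyU n) (RingQuot (BRel n k)))

instance (n k : ℕ) : Ring (B n k) := Algebra.semiringToRing (PolyU n)

/-- The quotient map onto `B(n,k)`. -/
def mkB (n k : ℕ) : B0 n k →ₐ[PolyU n] B n k := RingQuot.mkAlgHom (PolyU n) (BRel n k)

/-- The element `f_{x,y}` of `B(n,k)`. -/
def f {n k : ℕ} (x y : V n k) : B n k := mkB n k (f0 x y)

theorem f_mul_f {n k : ℕ} (x y z : V n k) :
    f x y * f y z = gMonomial n x.1 y.1 z.1 • f x z := by
  have h : f0 x y * f0 y z = gMonomial n x.1 y.1 z.1 • f0 x z := by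
    unfold f0
    rw [← map_mul, ← map_smul]
    exact RingQuot.mkAlgHom_rel _ (B0Rel.comp x y z)
  unfold f
  rw [← map_mul, h, map_smul]

theorem f_mul_f_of_ne {n k : ℕ} (x y z w : V n k) (hyz : y ≠ z) : f x y * f z w = 0 := by
  have h : f0 x y * f0 z w = 0 := by
    unfold f0
    rw [← map_mul, ← map_zero (mkB0 n k)]
    exact RingQuot.mkAlgHom_rel _ (B0Rel.not_composable x y z w hyz)
  unfold f
  rw [← map_mul, h, map_zero]

theorem gMonomial_left (n : ℕ) (x y : Finset ℕ) : gMonomial n x x y = 1 := by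
  have h : ∀ i, gExp x x y i = 0 := fun i => by simp [gExp, twoW]
  simp [gMonomial, h]

theorem gMonomial_right (n : ℕ) (x y : Finset ℕ) : gMonomial n x y y = 1 := by
  have h : ∀ i, gExp x y y i = 0 := fun i => by simp [gExp, twoW]
  simp [gMonomial, h]

theorem toV_injective {n k : ℕ} : Function.Injective (Vl.toV : Vl n k → V n k) := by
  intro x y h
  exact Subtype.ext (congrArg (fun a : V n k => a.1) h)

/-- The idempotent `∑_{x ∈ V_l(n,k)} I_x` of `B(n,k)`, where `I_x = f_{x,x}`. -/
def leftIdem (n k : ℕ) : B n k := ∑ x : Vl n k, f x.toV x.toV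

theorem leftIdem_mul_f {n k : ℕ} (x : Vl n k) (y : V n k) :
    leftIdem n k * f x.toV y = f x.toV y := by
  unfold leftIdem
  rw [Finset.sum_mul, Finset.sum_eq_single x]
  · rw [f_mul_f, gMonomial_left, one_smul]
  · intro z _ hz
    exact f_mul_f_of_ne _ _ _ _ (fun h => hz (toV_injective h))
  · intro h
    exact absurd (Finset.mem_univ x) h

theorem f_mul_leftIdem {n k : ℕ} (x : V n k) (y : Vl n k) :
    f x y.toV * leftIdem n k = f x y.toV := by
  unfold leftIdem
  rw [Finset.mul_sum, Finset.sum_eq_single y]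
  · rw [f_mul_f, gMonomial_right, one_smul]
  · intro z _ hz
    exact f_mul_f_of_ne _ _ _ _ (fun h => hz (toV_injective h).symm)
  · intro h
    exact absurd (Finset.mem_univ y) h

theorem leftIdem_isIdempotentElem (n k : ℕ) : IsIdempotentElem (leftIdem n k) := by
  change leftIdem n k * leftIdem n k = leftIdem n k
  conv_lhs => rw [leftIdem, Finset.sum_mul]
  unfold leftIdem
  refine Finset.sum_congr rfl fun x _ => ?_
  exact f_mul_leftIdem x.toV x

/-- The algebra `B_l(n,k) = e B(n,k) e`, where `e = ∑_{x ∈ V_l(n,k)} I_x`. -/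
def Bl (n k : ℕ) : Type := (leftIdem_isIdempotentElem n k).Corner

instance (n k : ℕ) : Ring (Bl n k) :=
  inferInstanceAs (Ring (leftIdem_isIdempotentElem n k).Corner)

/-- The inclusion of `B_l(n,k)` into `B(n,k)`. -/
def Bl.val {n k : ℕ} (a : Bl n k) : B n k := Subtype.val a

theorem Bl.val_injective {n k : ℕ} : Function.Injective (Bl.val : Bl n k → B n k) :=
  Subtype.val_injective

/-- The `ℤ[U_1, …, U_n]`-module structure on `B_l(n,k)` is inherited from `B(n,k)`. -/
instance (n k : ℕ) : SMul (PolyU n) (Bl n k) where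
  smul p a := ⟨p • a.val, by
    obtain ⟨b, hb⟩ := a.2
    refine ⟨p • b, ?_⟩
    change leftIdem n k * (p • b) * leftIdem n k = p • a.val
    rw [mul_smul_comm, smul_mul_assoc]
    exact congrArg (fun c => p • c) hb⟩

theorem Bl.val_smul {n k : ℕ} (p : PolyU n) (a : Bl n k) : (p • a).val = p • a.val := rfl

theorem Bl.val_mul {n k : ℕ} (a b : Bl n k) : (a * b).val = a.val * b.val := rfl

theorem Bl.val_add {n k : ℕ} (a b : Bl n k) : (a + b).val = a.val + b.val := rfl

theorem Bl.val_zero {n k : ℕ} : (0 : Bl n k).val = 0 := rfl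

instance (n k : ℕ) : Module (PolyU n) (Bl n k) where
  one_smul a := Bl.val_injective (by rw [Bl.val_smul, one_smul])
  mul_smul p q a := Bl.val_injective (by simp only [Bl.val_smul, mul_smul])
  smul_zero p := Bl.val_injective (by rw [Bl.val_smul, Bl.val_zero, smul_zero])
  smul_add p a b := Bl.val_injective (by simp only [Bl.val_smul, Bl.val_add, smul_add])
  add_smul p q a := Bl.val_injective (by simp only [Bl.val_smul, Bl.val_add, add_smul])
  zero_smul a := Bl.val_injective (by rw [Bl.val_smul, Bl.val_zero, zero_smul])

instance (n k : ℕ) : Algebra (PolyU n) (Bl n k) :=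
  Algebra.ofModule
    (fun p a b => Bl.val_injective (by simp only [Bl.val_smul, Bl.val_mul, smul_mul_assoc]))
    (fun p a b => Bl.val_injective (by simp only [Bl.val_smul, Bl.val_mul, mul_smul_comm]))

/-- The element `f_{x,y}` of `B_l(n,k)`, for left I-states `x` and `y`. -/
def fl {n k : ℕ} (x y : Vl n k) : Bl n k :=
  ⟨f x.toV y.toV, f x.toV y.toV, by
    change leftIdem n k * f x.toV y.toV * leftIdem n k = f x.toV y.toV
    rw [leftIdem_mul_f, f_mul_leftIdem]⟩

/-! ### The action of `S = ℤ[ε_1, …, ε_k]` -/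

/-- The polynomial ring `S = ℤ[ε_1, …, ε_k]`. -/
def S (k : ℕ) : Type := MvPolynomial (Fin k) ℤ

instance (k : ℕ) : CommRing (S k) := inferInstanceAs (CommRing (MvPolynomial (Fin k) ℤ))

/-- The variable `ε_{i + 1}` of `S`. -/
def eps {k : ℕ} (i : Fin k) : S k := (MvPolynomial.X i : MvPolynomial (Fin k) ℤ)

/-- The ring homomorphism `S → ℤ[U_1, …, U_n]` sending `ε_i` to `e_i(U_1, …, U_n)`. -/
def epsHom (n k : ℕ) : S k →+* PolyU n :=
  (MvPolynomial.aeval fun i : Fin k => MvPolynomial.esymm (Fin n) ℤ (i.1 + 1) :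
    MvPolynomial (Fin k) ℤ →ₐ[ℤ] PolyU n).toRingHom

instance (n k : ℕ) : Algebra (S k) (Bl n k) := Algebra.compHom (Bl n k) (epsHom n k)

theorem eps_smul {n k : ℕ} (i : Fin k) (a : Bl n k) :
    eps i • a = MvPolynomial.esymm (Fin n) ℤ (i.1 + 1) • a := by
  change epsHom n k (eps i) • a = _
  congr 1
  exact MvPolynomial.aeval_X _ i

/-! ### Fork elements -/

/-- The `k`-element sets `x` and `y` are too far: `|x_i - y_i| > 1` for some `i`. -/
def TooFar (k : ℕ) (x y : Finset ℕ) : Prop :=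
  ∃ i < k, 1 < |(nthElem x i : ℤ) - (nthElem y i : ℤ)|

/-- The order `x ≼ z` on `k`-element sets: `z_i ≤ x_i` for all `i`. -/
def Preceq (k : ℕ) (x z : Finset ℕ) : Prop := ∀ i < k, nthElem z i ≤ nthElem x i

/-- `[j + 1, j + l]` is a generating interval for `x` and `y`. Region `r` is fully used if it lies
in `x ∩ y`, and line `m` is uncrossed if `v_m^x = v_m^y`. -/
structure IsGeneratingInterval (n : ℕ) (x y : Finset ℕ) (j l : ℕ) : Prop where
  one_le : 1 ≤ l
  le_n : j + l ≤ n
  left_not_fully_used : j ∉ x ∩ y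
  right_not_fully_used : j + l ∉ x ∩ y
  fully_used : ∀ r, j + 1 ≤ r → r ≤ j + l - 1 → r ∈ x ∩ y
  uncrossed : ∀ m, j + 1 ≤ m → m ≤ j + l → weight x m = weight y m

open Classical in
/-- The set of all `j` such that some `[j + 1, j + l]` is a generating interval for `x` and `y`. -/
def genStarts (n : ℕ) (x y : Finset ℕ) : Finset ℕ :=
  (Finset.range (n + 1)).filter fun j => ∃ l, IsGeneratingInterval n x y j l

/-- The exponent `c_i = #{j < w⁻¹(i) | w(j) > i}`. -/
def codeExp {k : ℕ} (w : Equiv.Perm (Fin k)) (i : Fin k) : ℕ :=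
  (Finset.univ.filter fun j : Fin k => j < w⁻¹ i ∧ i < w j).card

/-- The staircase monomial `𝔖'_w(x_1, …, x_k) = ∏_i x_i ^ {c_i}`. -/
def schubertMonomial {k : ℕ} (w : Equiv.Perm (Fin k)) : MvPolynomial (Fin k) ℤ :=
  ∏ i : Fin k, MvPolynomial.X i ^ codeExp w i

theorem nthElem_lt {n k : ℕ} (z : Vl n k) (i : Fin k) : nthElem z.1 i.1 < n := by
  obtain ⟨hs, hc⟩ := Finset.mem_powersetCard.1 z.2
  have h : nthElem z.1 i.1 ∈ z.1 := by
    refine Nat.nth_mem (p := fun a => a ∈ z.1) i.1 fun hf => ?_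
    have : hf.toFinset = z.1 := by
      ext a
      rw [Set.Finite.mem_toFinset]
      rfl
    rw [this, hc]
    exact i.2
  exact Finset.mem_range.1 (hs h)

/-- The fork polynomial `p_{(x,z^σ,y)}`, equal to
`𝔖'_σ(U_{z_1 + 1}, …, U_{z_k + 1}) ∏_{i = 1}^{n - k} U_{j_i + 1} U_{j_i + 2} ⋯ U_{h_i^z}`, where
the generating intervals for `x` and `y` are `[j_i + 1, j_i + l_i]` for `1 ≤ i ≤ n - k`, in
increasing order. Recall that `U_{t + 1}` is `X t`. -/
def forkPoly {n k : ℕ} (x z : Vl n k) (σ : Equiv.Perm (Fin k)) (y : Vl n k) : PolyU n :=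
  MvPolynomial.aeval
      (fun i : Fin k => (MvPolynomial.X ⟨nthElem z.1 i.1, nthElem_lt z i⟩ : PolyU n))
      (schubertMonomial σ) *
    ∏ i ∈ Finset.range (n - k),
      ∏ t ∈ Finset.univ.filter
        (fun t : Fin n => nthElem (genStarts n x.1 y.1) i ≤ t.1 ∧ t.1 < hole n z.1 i),
        MvPolynomial.X t

/-- The index set of the fork elements: `x, y, z ∈ V_l(n,k)` no two of which are too far, with
`x ≼ z ≽ y`, and `σ ∈ S_k`. -/
@[ext]
structure ForkIndex (n k : ℕ) where
  x : Vl n k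
  z : Vl n k
  y : Vl n k
  σ : Equiv.Perm (Fin k)
  not_far_xy : ¬ TooFar k x.1 y.1
  not_far_xz : ¬ TooFar k x.1 z.1
  not_far_yz : ¬ TooFar k y.1 z.1
  x_preceq_z : Preceq k x.1 z.1
  y_preceq_z : Preceq k y.1 z.1

/-- The fork element `p_{(x,z^σ,y)} f_{x,y}` of `B_l(n,k)`. -/
def forkElement {n k : ℕ} (q : ForkIndex n k) : Bl n k :=
  forkPoly q.x q.z q.σ q.y • fl q.x q.y

end

end OzsvathSzabo

namespace OzsvathSzabo

/-! ### Weights -/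

/-! A state is encoded by its weight function `m ↦ v_m`, whose successive drops are `0` or `1`. In
these terms `x ≼ z` says `v^z ≤ v^x`, and "not too far" says `v^x_{m+1} ≤ v^y_m` and `v^y_{m+1} ≤
v^x_m`. The two conditions that a fork imposes on the pair `x`, `z` combine into `Near z x`: `v^x`
is `v^z` or `v^z + 1` on every line, with equality on line `h + 1` for each hole `h` of `z`.
Counting interval starts and holes to the left of a line shows that `U_m` occurs in the product over
generating intervals with exponent `min(v^x_m, v^y_m) - v^z_m` (`prod_genStarts_hole`). So a fork
polynomial is a staircase monomial in the variables attached to `z` times `baseMonomial x y z`.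

The classical input is that the staircase monomials, indexed by permutations through their codes,
form a basis of `ℤ[t_1, …, t_k]` over the symmetric polynomials. It applies for each `z` because
killing the `U_{t+1}` with `t ∉ z` sends `e_i(U_1, …, U_n)` to `e_i(t_1, …, t_k)`.

Independence. For each `z` the algebra acts on the states near `z` over `ℤ[U]` modulo the variables
at holes of `z`, and a matrix entry reads off the coefficient of `f_{x,y}` (`exists_coefficient`). A
monomial `baseMonomial x y w` that survives this reduction forces `w` to be near `z`, hence `v^w ≥
v^z`. The relation is thus triangular in the total weight, and the diagonal terms are staircase
monomials times a nonzero monomial in a domain.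

Generation. The arrows span over `ℤ[U]`, and `f_{x,y} = 0` when `x`, `y` are too far. Otherwise the
state `z` with `v^z = min(v^x, v^y)` has base monomial `1`. A multiple `p * baseMonomial x y z` is
reduced by writing `p` as a combination of staircase monomials modulo the variables at holes of `z`.
For such a hole `t`, the product `U_{t+1} * baseMonomial x y z` is either the base monomial of a
state of smaller total weight (`exists_near_of_mem`), or divisible by the product of the `U_i` over
a generating interval, which annihilates `f_{x,y}` (`X_mul_baseMonomial_smul_fl`). Induction on the
total weight finishes. -/

theorem weight_succ (x : Finset ℕ) (m : ℕ) :
    weight x m = weight x (m + 1) + if m ∈ x then 1 else 0 := by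
  unfold weight
  have h : x.filter (fun a => m ≤ a)
      = x.filter (fun a => m + 1 ≤ a) ∪ x.filter (fun a => a = m) := by
    ext a
    simp only [Finset.mem_filter, Finset.mem_union]
    constructor
    · rintro ⟨h1, h2⟩
      rcases Nat.eq_or_lt_of_le h2 with h | h
      · exact Or.inr ⟨h1, h.symm⟩
      · exact Or.inl ⟨h1, h⟩
    · rintro (⟨h1, h2⟩ | ⟨h1, h2⟩)
      · exact ⟨h1, by omega⟩
      · exact ⟨h1, by omega⟩
  rw [h, Finset.card_union_of_disjoint]
  · congr 1
    rw [Finset.filter_eq']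
    split_ifs <;> simp
  · rw [Finset.disjoint_filter]
    intro a _ h1 h2
    omega

theorem weight_of_mem {x : Finset ℕ} {m : ℕ} (h : m ∈ x) : weight x m = weight x (m + 1) + 1 := by
  rw [weight_succ, if_pos h]

theorem weight_of_notMem {x : Finset ℕ} {m : ℕ} (h : m ∉ x) : weight x m = weight x (m + 1) := by
  rw [weight_succ, if_neg h, add_zero]

theorem mem_iff_weight (x : Finset ℕ) (m : ℕ) : m ∈ x ↔ weight x m = weight x (m + 1) + 1 := by
  by_cases h : m ∈ x
  · simp [h, weight_of_mem h]
  · simp [h, weight_of_notMem h]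

theorem weight_succ_le (x : Finset ℕ) (m : ℕ) : weight x (m + 1) ≤ weight x m := by
  rw [weight_succ x m]; omega

theorem weight_le_succ (x : Finset ℕ) (m : ℕ) : weight x m ≤ weight x (m + 1) + 1 := by
  rw [weight_succ x m]; split_ifs <;> omega

theorem weight_antitone (x : Finset ℕ) : Antitone (weight x) :=
  antitone_nat_of_succ_le (weight_succ_le x)

theorem weight_zero (x : Finset ℕ) : weight x 0 = x.card := by
  simp [weight]

theorem weight_eq_zero {x : Finset ℕ} {N m : ℕ} (h : x ⊆ Finset.range N) (hm : N ≤ m) :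
    weight x m = 0 := by
  unfold weight
  rw [Finset.card_eq_zero, Finset.filter_eq_empty_iff]
  intro a ha h1
  have := Finset.mem_range.1 (h ha)
  omega

theorem eq_of_weight_eq {x y : Finset ℕ} (h : ∀ m, weight x m = weight y m) : x = y := by
  ext m
  rw [mem_iff_weight, mem_iff_weight, h, h]

/-- A function with unit or zero drops that vanishes at `N` is the weight function of a set. -/
theorem exists_weight_eq (v : ℕ → ℕ) (N : ℕ) (hN : v N = 0)
    (hv : ∀ m, v (m + 1) ≤ v m ∧ v m ≤ v (m + 1) + 1) :
    ∃ s ⊆ Finset.range N, ∀ m, weight s m = v m := by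
  have hanti : Antitone v := antitone_nat_of_succ_le fun m => (hv m).1
  refine ⟨(Finset.range N).filter fun m => v m = v (m + 1) + 1, Finset.filter_subset _ _, ?_⟩
  have hbig : ∀ m, N ≤ m → v m = 0 := fun m hm => Nat.eq_zero_of_le_zero (hN ▸ hanti hm)
  have key : ∀ d m, N ≤ m + d →
      weight ((Finset.range N).filter fun m => v m = v (m + 1) + 1) m = v m := by
    intro d
    induction d with
    | zero =>
      intro m hm
      rw [weight_eq_zero (Finset.filter_subset _ _) (by omega : N ≤ m), hbig m hm]
    | succ d ih =>
      intro m hm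
      rw [weight_succ, ih (m + 1) (by omega)]
      have h1 := hv m
      by_cases h : m < N
      · simp only [Finset.mem_filter, Finset.mem_range, h, true_and]
        split_ifs <;> omega
      · have h2 := hbig m (by omega)
        have h3 := hbig (m + 1) (by omega)
        rw [if_neg (by simp [h]), h2, h3]
  exact fun m => key N m (by omega)

/-! ### Comparing the elements of two sets through their weights. -/

theorem card_filter_lt_add_weight (s : Finset ℕ) (m : ℕ) :
    (s.filter (fun a => a < m)).card + weight s m = s.card := by
  rw [← Finset.card_filter_add_card_filter_not (s := s) (fun a => a < m)]
  simp [weight]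

/-- The element with index `i` lies below `m` exactly when more than `i` elements do, and `weight s
m` counts the others. This is the dictionary between sequences and weights. -/
theorem nthElem_lt_iff (s : Finset ℕ) {i : ℕ} (hi : i < s.card) (m : ℕ) :
    nthElem s i < m ↔ i + weight s m < s.card := by
  classical
  have hcount : Nat.count (fun a => a ∈ s) m = (s.filter (fun a => a < m)).card := by
    rw [Nat.count_eq_card_filter_range]
    congr 1
    ext a
    simp [and_comm]
  have h1 := card_filter_lt_add_weight s m
  rw [← hcount] at h1
  have h2 : nthElem s i < m ↔ i < Nat.count (fun a => a ∈ s) m := by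
    constructor
    · intro h
      by_contra h'
      have hfin : ∀ hf : (Set.ofPred fun a => a ∈ s).Finite, i < hf.toFinset.card := by
        intro hf
        have : hf.toFinset = s := by
          ext a
          rw [Set.Finite.mem_toFinset]
          rfl
        rwa [this]
      have h3 := Nat.count_nth_succ (p := fun a => a ∈ s) hfin
      have h4 : Nat.count (fun a => a ∈ s) (nthElem s i + 1) ≤ Nat.count (fun a => a ∈ s) m :=
        Nat.count_monotone _ h
      unfold nthElem at h4
      omega
    · exact Nat.nth_lt_of_lt_count
  rw [h2]
  omega

/-- The shift `c = 0` yields the order `≼`; the shift `c = 1`, used in both directions, yields "not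
too far". -/
theorem forall_nthElem_le_iff {k : ℕ} {x z : Finset ℕ} (hx : x.card = k) (hz : z.card = k)
    (c : ℕ) :
    (∀ i < k, nthElem z i ≤ nthElem x i + c) ↔ ∀ m, weight z (m + c) ≤ weight x m := by
  constructor
  · intro h m
    by_contra! h1
    have hzk : weight z (m + c) ≤ k := by
      rw [← hz, ← weight_zero]
      exact weight_antitone z (Nat.zero_le _)
    -- This index belongs to the smallest element of `z` that is at least `m + c`.
    have hi : k - weight z (m + c) < k := by omega
    have h2 := h _ hi
    have h3 := (nthElem_lt_iff x (i := k - weight z (m + c)) (by omega) m).2 (by omega)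
    have h4 := (nthElem_lt_iff z (i := k - weight z (m + c)) (by omega) (m + c)).1 (by omega)
    omega
  · intro h i hi
    have h1 := (nthElem_lt_iff x (i := i) (by omega) (nthElem x i + 1)).1 (by omega)
    have h2 := h (nthElem x i + 1)
    have h3 := (nthElem_lt_iff z (i := i) (by omega) (nthElem x i + 1 + c)).2 (by omega)
    omega

theorem preceq_iff_weight {k : ℕ} {x z : Finset ℕ} (hx : x.card = k) (hz : z.card = k) :
    Preceq k x z ↔ ∀ m, weight z m ≤ weight x m :=
  forall_nthElem_le_iff hx hz 0

theorem not_tooFar_iff_weight {k : ℕ} {x y : Finset ℕ} (hx : x.card = k) (hy : y.card = k) :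
    ¬ TooFar k x y ↔
      ∀ m, weight x (m + 1) ≤ weight y m ∧ weight y (m + 1) ≤ weight x m := by
  rw [forall_and, ← forall_nthElem_le_iff hy hx 1, ← forall_nthElem_le_iff hx hy 1]
  unfold TooFar
  push Not
  rw [← forall₂_and]
  refine forall₂_congr fun i _ => ?_
  rw [abs_le]
  omega

/-! ### Neighbouring states -/

/-- The weights of `x` and `z` agree on all lines directly to the right of regions not in `z`. -/
def Near (z x : Finset ℕ) : Prop := ∀ h, h ∉ z → weight x (h + 1) = weight z (h + 1)

theorem Near.le {z x : Finset ℕ} (h : Near z x) (hc : x.card = z.card) (m : ℕ) :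
    weight z m ≤ weight x m := by
  induction m with
  | zero => rw [weight_zero, weight_zero, hc]
  | succ m ih =>
    by_cases hm : m ∈ z
    · have h1 := weight_of_mem hm
      have h2 := weight_le_succ x m
      omega
    · exact (h m hm).ge

/-- The bound is propagated from the far right, where weights vanish: at a region of `z` the weight
of `z` also grows, and at a hole the two weights have just been equal. -/
theorem Near.le_succ {z x : Finset ℕ} (h : Near z x) (m : ℕ) :
    weight x m ≤ weight z m + 1 := by
  obtain ⟨N, hN⟩ : ∃ N, x ⊆ Finset.range N := x.exists_nat_subset_range
  have key : ∀ d m, N ≤ m + d → weight x m ≤ weight z m + 1 := by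
    intro d
    induction d with
    | zero =>
      intro m hm
      rw [weight_eq_zero hN (by omega : N ≤ m)]
      omega
    | succ d ih =>
      intro m hm
      have h1 := ih (m + 1) (by omega)
      have h2 := weight_le_succ x m
      by_cases hmz : m ∈ z
      · have := weight_of_mem hmz
        omega
      · have := weight_of_notMem hmz
        have := h m hmz
        omega
  exact key N m (by omega)

theorem near_iff_weight {z x : Finset ℕ} (hc : x.card = z.card) :
    Near z x ↔ ∀ m, weight z m ≤ weight x m ∧ weight x (m + 1) ≤ weight z m := by
  constructor
  · intro h m
    refine ⟨h.le hc m, ?_⟩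
    by_cases hm : m ∈ z
    · have := weight_of_mem hm
      have := h.le_succ (m + 1)
      omega
    · rw [h m hm]
      exact weight_succ_le z m
  · intro h m hm
    have h1 := weight_of_notMem hm
    have h2 := h m
    have h3 := h (m + 1)
    omega

theorem near_iff {k : ℕ} {x z : Finset ℕ} (hx : x.card = k) (hz : z.card = k) :
    Near z x ↔ ¬ TooFar k x z ∧ Preceq k x z := by
  rw [near_iff_weight (hx.trans hz.symm), not_tooFar_iff_weight hx hz, preceq_iff_weight hx hz]
  constructor
  · intro h
    exact ⟨fun m => ⟨(h m).2, (h (m + 1)).1.trans (weight_succ_le x m)⟩, fun m => (h m).1⟩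
  · rintro ⟨h1, h2⟩ m
    exact ⟨h2 m, (h1 m).1⟩

theorem not_tooFar_of_near {k : ℕ} {x y z : Finset ℕ} (hx : x.card = k) (hy : y.card = k)
    (hz : z.card = k) (hzx : Near z x) (hzy : Near z y) : ¬ TooFar k x y := by
  rw [not_tooFar_iff_weight hx hy]
  rw [near_iff_weight (hx.trans hz.symm)] at hzx
  rw [near_iff_weight (hy.trans hz.symm)] at hzy
  exact fun m => ⟨(hzx m).2.trans (hzy m).1, (hzy m).2.trans (hzx m).1⟩

/-- If `t` is in `z` then a state near `z` contains `t` or `t + 1`. -/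
theorem Near.mem_or_mem {z x : Finset ℕ} (h : Near z x) (hc : x.card = z.card) {t : ℕ}
    (ht : t ∈ z) : t ∈ x ∨ t + 1 ∈ x := by
  by_contra! h'
  have h1 := weight_of_notMem h'.1
  have h2 : weight x (t + 1) = weight x (t + 2) := weight_of_notMem h'.2
  have h3 := weight_of_mem ht
  have h4 := h.le hc t
  have h5 := h.le_succ (t + 2)
  by_cases h6 : t + 1 ∈ z
  · have : weight z (t + 1) = weight z (t + 2) + 1 := weight_of_mem h6
    omega
  · have : weight z (t + 1) = weight z (t + 2) := weight_of_notMem h6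
    have : weight x (t + 2) = weight z (t + 2) := h (t + 1) h6
    omega

/-- If `t` and `t + 1` are in `z` then a state near `z` contains at least two of `t`, `t + 1`
and `t + 2`. -/
theorem Near.mem_of_notMem {z x : Finset ℕ} (h : Near z x) (hc : x.card = z.card) {t : ℕ}
    (ht : t ∈ z) (ht' : t + 1 ∈ z) (hx : t ∉ x) : t + 2 ∈ x := by
  by_contra h'
  have h1 := weight_of_notMem hx
  have h2 : weight x (t + 2) = weight x (t + 3) := weight_of_notMem h'
  have h3 := weight_of_mem ht
  have h4 : weight z (t + 1) = weight z (t + 2) + 1 := weight_of_mem ht'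
  have h5 := h.le hc t
  have h6 := h.le_succ (t + 3)
  have h7 : weight x (t + 1) ≤ weight x (t + 2) + 1 := weight_le_succ x (t + 1)
  by_cases h9 : t + 2 ∈ z
  · have : weight z (t + 2) = weight z (t + 3) + 1 := weight_of_mem h9
    omega
  · have : weight z (t + 2) = weight z (t + 3) := weight_of_notMem h9
    have : weight x (t + 3) = weight z (t + 3) := h (t + 2) h9
    omega

/-! ### Construction of states -/

theorem V.card_eq {n k : ℕ} (x : V n k) : x.1.card = k := (Finset.mem_powersetCard.1 x.2).2

theorem V.subset_range {n k : ℕ} (x : V n k) : x.1 ⊆ Finset.range (n + 1) :=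
  (Finset.mem_powersetCard.1 x.2).1

theorem Vl.card_eq {n k : ℕ} (x : Vl n k) : x.1.card = k := (Finset.mem_powersetCard.1 x.2).2

theorem Vl.subset_range {n k : ℕ} (x : Vl n k) : x.1 ⊆ Finset.range n :=
  (Finset.mem_powersetCard.1 x.2).1

theorem V.weight_zero {n k : ℕ} (x : V n k) : weight x.1 0 = k := by
  rw [OzsvathSzabo.weight_zero, x.card_eq]

theorem Vl.weight_zero {n k : ℕ} (x : Vl n k) : weight x.1 0 = k := by
  rw [OzsvathSzabo.weight_zero, x.card_eq]

theorem V.weight_eq_zero {n k : ℕ} (x : V n k) {m : ℕ} (hm : n < m) : weight x.1 m = 0 :=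
  OzsvathSzabo.weight_eq_zero x.subset_range hm

theorem Vl.weight_eq_zero {n k : ℕ} (x : Vl n k) {m : ℕ} (hm : n ≤ m) : weight x.1 m = 0 :=
  OzsvathSzabo.weight_eq_zero x.subset_range hm

theorem V.exists_weight_eq {n k : ℕ} (v : ℕ → ℕ) (h0 : v 0 = k) (hn : v (n + 1) = 0)
    (hv : ∀ m, v (m + 1) ≤ v m ∧ v m ≤ v (m + 1) + 1) : ∃ x : V n k, ∀ m, weight x.1 m = v m := by
  obtain ⟨s, hs, h⟩ := OzsvathSzabo.exists_weight_eq v (n + 1) hn hv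
  refine ⟨⟨s, Finset.mem_powersetCard.2 ⟨hs, ?_⟩⟩, h⟩
  rw [← OzsvathSzabo.weight_zero, h, h0]

theorem Vl.exists_weight_eq {n k : ℕ} (v : ℕ → ℕ) (h0 : v 0 = k) (hn : v n = 0)
    (hv : ∀ m, v (m + 1) ≤ v m ∧ v m ≤ v (m + 1) + 1) : ∃ x : Vl n k, ∀ m, weight x.1 m = v m := by
  obtain ⟨s, hs, h⟩ := OzsvathSzabo.exists_weight_eq v n hn hv
  refine ⟨⟨s, Finset.mem_powersetCard.2 ⟨hs, ?_⟩⟩, h⟩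
  rw [← OzsvathSzabo.weight_zero, h, h0]

/-! ### Fork polynomials in terms of weights -/

/-- The right end of an interval is forced: it is the first region after `j` not fully used, and it
exists because `n` lies in no left state. Being uncrossed then spreads from line `j + 1` along fully
used regions. -/
theorem mem_genStarts {n k : ℕ} (x y : Vl n k) (j : ℕ) :
    j ∈ genStarts n x.1 y.1 ↔
      j < n ∧ j ∉ x.1 ∩ y.1 ∧ weight x.1 (j + 1) = weight y.1 (j + 1) := by
  classical
  unfold genStarts
  rw [Finset.mem_filter]
  constructor
  · rintro ⟨_, l, h⟩
    have h1 := h.one_le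
    have h2 := h.le_n
    exact ⟨by omega, h.left_not_fully_used, h.uncrossed (j + 1) le_rfl (by omega)⟩
  · rintro ⟨hj, hj', hw⟩
    have hex : ∃ l, 1 ≤ l ∧ j + l ∉ x.1 ∩ y.1 := by
      refine ⟨n - j, by omega, fun h => ?_⟩
      have := Finset.mem_range.1 (x.subset_range (Finset.mem_inter.1 h).1)
      omega
    have hl := Nat.find_spec hex
    have hmin : ∀ m, m < Nat.find hex → 1 ≤ m → j + m ∈ x.1 ∩ y.1 := by
      intro m hm h1
      by_contra h2
      exact Nat.find_min hex hm ⟨h1, h2⟩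
    generalize Nat.find hex = l at hl hmin
    have hused : ∀ r, j + 1 ≤ r → r ≤ j + l - 1 → r ∈ x.1 ∩ y.1 := by
      intro r h1 h2
      have := hmin (r - j) (by omega) (by omega)
      rwa [show j + (r - j) = r by omega] at this
    refine ⟨Finset.mem_range.2 (by omega), l, hl.1, ?_, hj', hl.2, hused, ?_⟩
    · by_contra h
      have := hused n (by omega) (by omega)
      have := Finset.mem_range.1 (x.subset_range (Finset.mem_inter.1 this).1)
      omega
    · intro m h1 h2
      induction m, h1 using Nat.le_induction with
      | base => exact hw
      | succ m h1 ih =>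
        have h3 := Finset.mem_inter.1 (hused m h1 (by omega))
        have h4 := ih (by omega)
        rw [weight_of_mem h3.1, weight_of_mem h3.2] at h4
        omega

theorem card_filter_lt_succ (s : Finset ℕ) (m : ℕ) :
    (s.filter (fun a => a < m + 1)).card
      = (s.filter (fun a => a < m)).card + if m ∈ s then 1 else 0 := by
  have h1 := card_filter_lt_add_weight s m
  have h2 := card_filter_lt_add_weight s (m + 1)
  have h3 := weight_succ s m
  split_ifs at h3 ⊢ <;> omega

/-- Region by region: "not too far" keeps the two weights within one of each other, and then region
`m` starts an interval exactly when the minimum of the weights does not drop across it. -/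
theorem card_genStarts_filter_lt {n k : ℕ} (x y : Vl n k) (h : ¬ TooFar k x.1 y.1) (m : ℕ)
    (hm : m ≤ n) :
    ((genStarts n x.1 y.1).filter (fun a => a < m)).card + k
      = m + min (weight x.1 m) (weight y.1 m) := by
  rw [not_tooFar_iff_weight x.card_eq y.card_eq] at h
  induction m with
  | zero => simp [x.weight_zero, y.weight_zero]
  | succ m ih =>
    have ih := ih (by omega)
    rw [card_filter_lt_succ]
    have hmem : m ∈ genStarts n x.1 y.1 ↔ _ := mem_genStarts x y m
    have h1 := h m
    have h2 := h (m + 1)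
    have hx := weight_succ x.1 m
    have hy := weight_succ y.1 m
    rw [Finset.mem_inter] at hmem
    simp only [hmem, show m < n by omega, true_and]
    by_cases h3 : m ∈ x.1 <;> by_cases h4 : m ∈ y.1 <;>
      simp only [h3, h4, if_true, if_false, not_true_eq_false, not_false_eq_true, true_and,
        and_true, false_and, and_false] at hx hy ⊢ <;>
      (try split_ifs) <;> omega

theorem card_genStarts {n k : ℕ} (x y : Vl n k) (h : ¬ TooFar k x.1 y.1) :
    (genStarts n x.1 y.1).card = n - k := by
  have h1 := card_genStarts_filter_lt x y h n le_rfl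
  rw [x.weight_eq_zero le_rfl, y.weight_eq_zero le_rfl, Finset.filter_true_of_mem] at h1
  · omega
  · intro a ha
    exact ((mem_genStarts x y a).1 ha).1

theorem card_holes_filter_lt {n k : ℕ} (z : Vl n k) (m : ℕ) (hm : m ≤ n + 1) :
    ((Finset.range (n + 1) \ z.1).filter (fun a => a < m)).card + k = m + weight z.1 m := by
  induction m with
  | zero => simp [z.weight_zero]
  | succ m ih =>
    have ih := ih (by omega)
    rw [card_filter_lt_succ]
    have hz := weight_succ z.1 m
    have hmem : m ∈ Finset.range (n + 1) \ z.1 ↔ m ∉ z.1 := by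
      rw [Finset.mem_sdiff, Finset.mem_range]
      exact and_iff_right (by omega)
    simp only [hmem]
    split_ifs at hz ⊢ <;> first | contradiction | omega

theorem card_holes {n k : ℕ} (z : Vl n k) : (Finset.range (n + 1) \ z.1).card + k = n + 1 := by
  have h := card_holes_filter_lt z (n + 1) le_rfl
  rw [z.weight_eq_zero (by omega), Finset.filter_true_of_mem] at h
  · exact h
  · intro a ha
    exact Finset.mem_range.1 (Finset.mem_sdiff.1 ha).1

/-- The monomial of a fork polynomial that does not depend on the permutation. -/
noncomputable def baseMonomial {n k : ℕ} (x y z : Vl n k) : PolyU n :=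
  ∏ t : Fin n, MvPolynomial.X t ^
    (min (weight x.1 (t.1 + 1)) (weight y.1 (t.1 + 1)) - weight z.1 (t.1 + 1))

theorem prod_genStarts_hole {n k : ℕ} (x y z : Vl n k) (h : ¬ TooFar k x.1 y.1) :
    ∏ i ∈ Finset.range (n - k),
      ∏ t ∈ Finset.univ.filter
        (fun t : Fin n => nthElem (genStarts n x.1 y.1) i ≤ t.1 ∧ t.1 < hole n z.1 i),
        (MvPolynomial.X t : PolyU n) = baseMonomial x y z := by
  rw [Finset.prod_comm' (t' := Finset.univ) (s' := fun t : Fin n => (Finset.range (n - k)).filter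
    fun i => nthElem (genStarts n x.1 y.1) i ≤ t.1 ∧ t.1 < hole n z.1 i)]
  · refine Finset.prod_congr rfl fun t _ => ?_
    rw [Finset.prod_const]
    congr 1
    have hG := card_genStarts x y h
    have hH := card_holes z
    have h1 := card_genStarts_filter_lt x y h (t.1 + 1) t.2
    have h2 := card_holes_filter_lt z (t.1 + 1) (by omega)
    have h3 := card_filter_lt_add_weight (genStarts n x.1 y.1) (t.1 + 1)
    have h4 := card_filter_lt_add_weight (Finset.range (n + 1) \ z.1) (t.1 + 1)
    -- The exponent of `U_{t+1}` counts the `i` with `j_i ≤ t < h_i`. The first inequality says that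
    -- more than `i` starts lie at or before `t`, the second that at most `i` holes do.
    have h5 : (Finset.range (n - k)).filter
        (fun i => nthElem (genStarts n x.1 y.1) i ≤ t.1 ∧ t.1 < hole n z.1 i)
        = Finset.Ico ((Finset.range (n + 1) \ z.1).filter (fun a => a < t.1 + 1)).card
          ((genStarts n x.1 y.1).filter (fun a => a < t.1 + 1)).card := by
      ext i
      rw [Finset.mem_filter, Finset.mem_range, Finset.mem_Ico]
      constructor
      · rintro ⟨h6, h7, h8⟩
        have h9 := (nthElem_lt_iff (genStarts n x.1 y.1) (i := i) (by omega) (t.1 + 1)).1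
          (by omega)
        have h10 := (nthElem_lt_iff (Finset.range (n + 1) \ z.1) (i := i) (by omega)
          (t.1 + 1)).not.1 (by unfold hole at h8; omega)
        omega
      · rintro ⟨h6, h7⟩
        have h9 := (nthElem_lt_iff (genStarts n x.1 y.1) (i := i) (by omega) (t.1 + 1)).2
          (by omega)
        have h10 := (nthElem_lt_iff (Finset.range (n + 1) \ z.1) (i := i) (by omega)
          (t.1 + 1)).not.2 (by omega)
        exact ⟨by omega, by omega, by unfold hole; omega⟩
    rw [h5, Nat.card_Ico]
    omega
  · intro i t
    simp

/-- The monomial `𝔖'_σ(U_{z_1 + 1}, …, U_{z_k + 1})`. -/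
noncomputable def schubertAt {n k : ℕ} (z : Vl n k) (σ : Equiv.Perm (Fin k)) : PolyU n :=
  MvPolynomial.aeval
    (fun i : Fin k => (MvPolynomial.X ⟨nthElem z.1 i.1, nthElem_lt z i⟩ : PolyU n))
    (schubertMonomial σ)

theorem forkPoly_eq {n k : ℕ} (x z : Vl n k) (σ : Equiv.Perm (Fin k)) (y : Vl n k)
    (h : ¬ TooFar k x.1 y.1) : forkPoly x z σ y = schubertAt z σ * baseMonomial x y z := by
  unfold forkPoly schubertAt
  rw [prod_genStarts_hole x y z h]

namespace ForkIndex

variable {n k : ℕ}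

theorem near_x (q : ForkIndex n k) : Near q.z.1 q.x.1 :=
  (near_iff q.x.card_eq q.z.card_eq).2 ⟨q.not_far_xz, q.x_preceq_z⟩

theorem near_y (q : ForkIndex n k) : Near q.z.1 q.y.1 :=
  (near_iff q.y.card_eq q.z.card_eq).2 ⟨q.not_far_yz, q.y_preceq_z⟩

/-- The fork index given by states `x` and `y` near `z` and a permutation. -/
def ofNear (x y z : Vl n k) (σ : Equiv.Perm (Fin k)) (hx : Near z.1 x.1) (hy : Near z.1 y.1) :
    ForkIndex n k where
  x := x
  z := z
  y := y
  σ := σ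
  not_far_xy := not_tooFar_of_near x.card_eq y.card_eq z.card_eq hx hy
  not_far_xz := ((near_iff x.card_eq z.card_eq).1 hx).1
  not_far_yz := ((near_iff y.card_eq z.card_eq).1 hy).1
  x_preceq_z := ((near_iff x.card_eq z.card_eq).1 hx).2
  y_preceq_z := ((near_iff y.card_eq z.card_eq).1 hy).2

end ForkIndex

theorem forkElement_eq {n k : ℕ} (q : ForkIndex n k) :
    forkElement q = (schubertAt q.z q.σ * baseMonomial q.x q.y q.z) • fl q.x q.y := by
  rw [forkElement, forkPoly_eq _ _ _ _ q.not_far_xy]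

/-! ### Vanishing of arrows -/

variable {n k : ℕ}

/-- The weights of `y` lie between those of `x` and `z`. -/
def Between (x y z : Finset ℕ) : Prop :=
  ∀ m, (weight x m ≤ weight y m ∧ weight y m ≤ weight z m) ∨
    (weight z m ≤ weight y m ∧ weight y m ≤ weight x m)

theorem twoW_eq_max_sub_min (x y : Finset ℕ) (i : ℕ) :
    twoW x y i = max (weight x i : ℤ) (weight y i) - min (weight x i : ℤ) (weight y i) := by
  unfold twoW
  rw [max_sub_min_eq_abs']

theorem gExp_eq_zero {x y z : Finset ℕ} (h : Between x y z) (i : ℕ) : gExp x y z i = 0 := by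
  have h1 := two_mul_gExp x y z i
  have h2 := h i
  simp only [twoW_eq_max_sub_min] at h1
  omega

theorem gMonomial_of_between {x y z : Finset ℕ} (h : Between x y z) : gMonomial n x y z = 1 := by
  simp [gMonomial, gExp_eq_zero h]

/-- On every line the distances `|v^x - v^y|` and `|v^y - v^z|` add up, so all exponents `g_i`
vanish. -/
theorem f_eq_mul {x y z : V n k} (h : Between x.1 y.1 z.1) : f x z = f x y * f y z := by
  rw [f_mul_f, gMonomial_of_between h, one_smul]

open Classical in
theorem mkB_elemR (t : ℕ) : mkB n k (elemR n k t) = ∑ x : V n k, ∑ y : V n k,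
    if x.1 ∩ {t, t + 1} = {t} ∧ y.1 = (x.1 \ {t}) ∪ {t + 1} then f x y else 0 := by
  simp only [elemR, map_sum, apply_ite, map_zero]
  rfl

open Classical in
theorem mkB_elemL (t : ℕ) : mkB n k (elemL n k t) = ∑ x : V n k, ∑ y : V n k,
    if x.1 ∩ {t, t + 1} = {t + 1} ∧ y.1 = (x.1 \ {t + 1}) ∪ {t} then f x y else 0 := by
  simp only [elemL, map_sum, apply_ite, map_zero]
  rfl

theorem f_mul_sum_ite (a x y : V n k) (P : V n k → V n k → Prop) [∀ u w, Decidable (P u w)]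
    (hP : ∀ w, P x w ↔ w = y) :
    f a x * (∑ u : V n k, ∑ w : V n k, if P u w then f u w else 0) = f a x * f x y := by
  rw [Finset.mul_sum, Finset.sum_eq_single x]
  · congr 1
    rw [Finset.sum_eq_single y]
    · rw [if_pos ((hP y).2 rfl)]
    · intro w _ hw
      rw [if_neg fun h => hw ((hP w).1 h)]
    · intro h
      exact absurd (Finset.mem_univ y) h
  · intro u _ hu
    rw [Finset.mul_sum]
    refine Finset.sum_eq_zero fun w _ => ?_
    split_ifs
    · exact f_mul_f_of_ne _ _ _ _ (Ne.symm hu)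
    · exact mul_zero _
  · intro h
    exact absurd (Finset.mem_univ x) h

theorem inter_pair_eq_left {x : Finset ℕ} {a b : ℕ} (ha : a ∈ x) (hb : b ∉ x) :
    x ∩ {a, b} = {a} := by
  ext c
  simp only [Finset.mem_inter, Finset.mem_insert, Finset.mem_singleton]
  constructor
  · rintro ⟨h, rfl | rfl⟩
    · rfl
    · exact absurd h hb
  · rintro rfl
    exact ⟨ha, Or.inl rfl⟩

theorem inter_pair_eq_right {x : Finset ℕ} {a b : ℕ} (ha : a ∉ x) (hb : b ∈ x) :
    x ∩ {a, b} = {b} := by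
  rw [Finset.pair_comm]
  exact inter_pair_eq_left hb ha

theorem f_mul_mkB_elemR (a : V n k) {x y : V n k} {t : ℕ} (h1 : t ∈ x.1) (h2 : t + 1 ∉ x.1)
    (hy : y.1 = (x.1 \ {t}) ∪ {t + 1}) : f a x * mkB n k (elemR n k t) = f a x * f x y := by
  rw [mkB_elemR]
  refine f_mul_sum_ite a x y _ fun w => ?_
  rw [inter_pair_eq_left h1 h2, ← hy, Subtype.ext_iff]
  simp

theorem f_mul_mkB_elemL (a : V n k) {x y : V n k} {t : ℕ} (h1 : t ∉ x.1) (h2 : t + 1 ∈ x.1)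
    (hy : y.1 = (x.1 \ {t + 1}) ∪ {t}) : f a x * mkB n k (elemL n k t) = f a x * f x y := by
  rw [mkB_elemL]
  refine f_mul_sum_ite a x y _ fun w => ?_
  rw [inter_pair_eq_right h1 h2, ← hy, Subtype.ext_iff]
  simp

/-- A state whose weights exceed those of `x` by one on line `t + 1` only. -/
theorem eq_sdiff_union_of_weight {x y : Finset ℕ} {t : ℕ} (ht : t ∈ x) (ht' : t + 1 ∉ x)
    (hy : ∀ m, weight y m = weight x m + if m = t + 1 then 1 else 0) :
    y = (x \ {t}) ∪ {t + 1} := by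
  ext m
  rw [mem_iff_weight, hy, hy]
  simp only [Finset.mem_union, Finset.mem_sdiff, Finset.mem_singleton, mem_iff_weight x]
  rw [mem_iff_weight] at ht ht'
  rcases eq_or_ne m t with rfl | h1
  · simp [ht]
  · rcases eq_or_ne m (t + 1) with rfl | h2
    · have := weight_of_notMem (x := x) (m := t + 1) (by rwa [mem_iff_weight])
      simp [this]
    · simp [h1, h2]

theorem eq_sdiff_union_of_weight' {x y : Finset ℕ} {t : ℕ} (ht : t ∉ x) (ht' : t + 1 ∈ x)
    (hy : ∀ m, weight x m = weight y m + if m = t + 1 then 1 else 0) :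
    y = (x \ {t + 1}) ∪ {t} := by
  ext m
  rw [mem_iff_weight]
  simp only [Finset.mem_union, Finset.mem_sdiff, Finset.mem_singleton, mem_iff_weight x]
  rw [mem_iff_weight] at ht'
  have ht := weight_of_notMem ht
  have h1 := hy m
  have h2 := hy (m + 1)
  rcases eq_or_ne m t with rfl | h3
  · simp at h1 h2
    simp
    omega
  · rcases eq_or_ne m (t + 1) with rfl | h4
    · simp at h1 h2
      simp
      omega
    · simp [h3, h4] at h1 h2 ⊢
      rw [h1, h2]

/-- A particle cannot cross two consecutive lines to the right. -/
theorem f_eq_zero_of_right {x y w : V n k} {t : ℕ} (h0 : t ∈ x.1) (h1 : t + 1 ∉ x.1)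
    (h2 : t + 2 ∉ x.1) (ht : t + 2 ≤ n)
    (hy : ∀ m, weight y.1 m = weight x.1 m + if m = t + 1 then 1 else 0)
    (hw : ∀ m, weight w.1 m = weight y.1 m + if m = t + 2 then 1 else 0) : f x w = 0 := by
  have hy' := eq_sdiff_union_of_weight h0 h1 hy
  have hy1 : t + 1 ∈ y.1 := by simp [hy']
  have hy2 : t + 1 + 1 ∉ y.1 := by simp [hy', h2]
  have hw' := eq_sdiff_union_of_weight hy1 hy2 hw
  have h3 : mkB n k (elemR n k t) * mkB n k (elemR n k (t + 1)) = 0 := by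
    rw [← map_mul, ← map_zero (mkB n k)]
    exact RingQuot.mkAlgHom_rel _ (BRel.RR t ht)
  have h4 := congrArg (fun b => f x x * b) h3
  simp only [mul_zero] at h4
  rw [← mul_assoc, f_mul_mkB_elemR x h0 h1 hy', ← f_eq_mul, f_mul_mkB_elemR x hy1 hy2 hw',
    ← f_eq_mul] at h4
  · exact h4
  · intro m
    have := hw m
    have := hy m
    omega
  · intro m
    have := hy m
    omega

/-- A particle cannot cross two consecutive lines to the left. -/
theorem f_eq_zero_of_left {x y w : V n k} {t : ℕ} (h0 : t ∉ w.1) (h1 : t + 1 ∉ w.1)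
    (h2 : t + 2 ∈ w.1) (ht : t + 2 ≤ n)
    (hw : ∀ m, weight w.1 m = weight y.1 m + if m = t + 2 then 1 else 0)
    (hy : ∀ m, weight y.1 m = weight x.1 m + if m = t + 1 then 1 else 0) : f w x = 0 := by
  have hy' := eq_sdiff_union_of_weight' h1 h2 hw
  have hy1 : t + 1 ∈ y.1 := by simp [hy']
  have hy0 : t ∉ y.1 := by simp [hy', h0]
  have hx' := eq_sdiff_union_of_weight' hy0 hy1 hy
  have h3 : mkB n k (elemL n k (t + 1)) * mkB n k (elemL n k t) = 0 := by
    rw [← map_mul, ← map_zero (mkB n k)]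
    exact RingQuot.mkAlgHom_rel _ (BRel.LL t ht)
  have h4 := congrArg (fun b => f w w * b) h3
  simp only [mul_zero] at h4
  rw [← mul_assoc, f_mul_mkB_elemL w h1 h2 hy', ← f_eq_mul, f_mul_mkB_elemL w hy0 hy1 hx',
    ← f_eq_mul] at h4
  · exact h4
  · intro m
    have := hw m
    have := hy m
    omega
  · intro m
    have := hw m
    omega

/-- The hypothesis means that some particle has to cross two lines. The path from `x` to `y` can be
routed without detour so that on the segment from `u` to `w` a single particle moves from `t` to `t
+ 2`, all others resting. -/
theorem exists_hop {x y : V n k} {m : ℕ} (h : weight x.1 m < weight y.1 (m + 1)) :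
    ∃ u v w : V n k, ∃ t, t + 2 ≤ n ∧ t ∈ u.1 ∧ t + 1 ∉ u.1 ∧ t + 2 ∉ u.1 ∧
      t ∉ w.1 ∧ t + 1 ∉ w.1 ∧ t + 2 ∈ w.1 ∧
      (∀ m, weight v.1 m = weight u.1 m + if m = t + 1 then 1 else 0) ∧
      (∀ m, weight w.1 m = weight v.1 m + if m = t + 2 then 1 else 0) ∧
      Between x.1 u.1 y.1 ∧ Between u.1 w.1 y.1 := by
  have hm : m ≠ 0 := by
    rintro rfl
    have := weight_succ_le y.1 0
    rw [x.weight_zero] at h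
    rw [y.weight_zero] at this
    omega
  obtain ⟨t, rfl⟩ := Nat.exists_eq_succ_of_ne_zero hm
  simp only [Nat.succ_eq_add_one, add_assoc, Nat.reduceAdd] at h
  have ht : t + 2 ≤ n := by
    by_contra! h'
    rw [y.weight_eq_zero h'] at h
    omega
  obtain ⟨a, ha⟩ : ∃ a, weight x.1 (t + 1) = a := ⟨_, rfl⟩
  have hyt : weight y.1 (t + 2) ≤ weight y.1 (t + 1) := weight_succ_le _ _
  have hyt' : weight y.1 (t + 2) ≤ weight y.1 (t + 3) + 1 := weight_le_succ _ _
  have hxt : weight x.1 t ≤ weight x.1 (t + 1) + 1 := weight_le_succ _ _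
  have hxt' : weight x.1 (t + 3) ≤ weight x.1 (t + 1) := weight_antitone _ (by omega)
  have hxt2 : weight x.1 (t + 2) ≤ weight x.1 (t + 1) := weight_antitone _ (by omega)
  have hyk : weight y.1 (t + 2) ≤ weight y.1 0 := weight_antitone _ (by omega)
  have hx0 := x.weight_zero
  have hy0 := y.weight_zero
  have hxn := x.weight_eq_zero (m := n + 1) (by omega)
  have hyn := y.weight_eq_zero (m := n + 1) (by omega)
  -- With `a = v^x_{t+1} < v^y_{t+2}`, the truncation takes values between those of `x` and `y`, is
  -- `a + 1` at `t` and is `a` at `t + 1`, `t + 2`, `t + 3`. Adding `c₁` and `c₂` on the middle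
  -- lines gives `u`, `v` and `w`.
  have key : ∀ c₁ c₂, c₁ ≤ 1 → c₂ ≤ c₁ →
      ∃ u : V n k, ∀ m, weight u.1 m =
        (if m ≤ t then max (weight x.1 m) (a + 1)
          else min a (max (weight x.1 m) (weight y.1 m)))
        + (if m = t + 1 then c₁ else 0) + (if m = t + 2 then c₂ else 0) := by
    intro c₁ c₂ h1 h2
    refine V.exists_weight_eq _ ?_ ?_ ?_
    · simp [hx0]
      omega
    · rw [if_neg (by omega), hxn, hyn]
      simp
      omega
    · intro m
      have h3 := weight_succ_le x.1 m
      have h4 := weight_le_succ x.1 m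
      have h5 := weight_succ_le y.1 m
      have h6 := weight_le_succ y.1 m
      rcases lt_trichotomy m t with h7 | rfl | h7
      · simp only [show m ≤ t by omega, show m + 1 ≤ t by omega, show ¬ m = t + 1 by omega,
          show ¬ m = t + 2 by omega, show ¬ m + 1 = t + 1 by omega,
          show ¬ m + 1 = t + 2 by omega, if_true, if_false]
        omega
      · simp
        omega
      · rcases eq_or_ne m (t + 1) with rfl | h8
        · simp only [add_assoc, Nat.reduceAdd] at h3 h4 h5 h6 ⊢
          simp
          omega
        · rcases eq_or_ne m (t + 2) with rfl | h9
          · simp only [add_assoc, Nat.reduceAdd] at h3 h4 h5 h6 ⊢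
            simp
            omega
          · simp only [show ¬ m ≤ t by omega, show ¬ m + 1 ≤ t by omega, h8, h9,
              show ¬ m + 1 = t + 1 by omega, show ¬ m + 1 = t + 2 by omega, if_false]
            omega
  obtain ⟨u, hu⟩ := key 0 0 (by omega) (by omega)
  obtain ⟨v, hv⟩ := key 1 0 (by omega) (by omega)
  obtain ⟨w, hw⟩ := key 1 1 (by omega) (by omega)
  have hut : weight u.1 t = max (weight x.1 t) (a + 1) := by simp [hu]
  have hut1 : weight u.1 (t + 1) = min a (max (weight x.1 (t + 1)) (weight y.1 (t + 1))) := by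
    simp [hu]
  have hut2 : weight u.1 (t + 2) = min a (max (weight x.1 (t + 2)) (weight y.1 (t + 2))) := by
    simp [hu]
  have hut3 : weight u.1 (t + 3) = min a (max (weight x.1 (t + 3)) (weight y.1 (t + 3))) := by
    simp [hu]
  have hwu : ∀ m, weight w.1 m = weight u.1 m + (if m = t + 1 then 1 else 0)
      + if m = t + 2 then 1 else 0 := by
    intro m
    rw [hu, hw]
    split_ifs <;> omega
  have hwt : weight w.1 t = weight u.1 t := by simp [hwu]
  have hwt1 : weight w.1 (t + 1) = weight u.1 (t + 1) + 1 := by simp [hwu]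
  have hwt2 : weight w.1 (t + 2) = weight u.1 (t + 2) + 1 := by simp [hwu]
  have hwt3 : weight w.1 (t + 3) = weight u.1 (t + 3) := by simp [hwu]
  have hbu : ∀ m, m ≤ t → a + 1 ≤ weight y.1 m := fun m hm => by
    have := weight_antitone y.1 (show m ≤ t + 1 by omega)
    omega
  have hbu' : ∀ m, t < m → weight x.1 m ≤ a := fun m hm => by
    have := weight_antitone x.1 (show t + 1 ≤ m by omega)
    omega
  refine ⟨u, v, w, t, ht, ?_, ?_, ?_, ?_, ?_, ?_, ?_, ?_, ?_, ?_⟩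
  · rw [mem_iff_weight]; omega
  · rw [mem_iff_weight]; simp only [add_assoc, Nat.reduceAdd]; omega
  · rw [mem_iff_weight]; simp only [add_assoc, Nat.reduceAdd]; omega
  · rw [mem_iff_weight]; omega
  · rw [mem_iff_weight]; simp only [add_assoc, Nat.reduceAdd]; omega
  · rw [mem_iff_weight]; simp only [add_assoc, Nat.reduceAdd]; omega
  · intro m
    rw [hu, hv]
    split_ifs <;> omega
  · intro m
    rw [hw, hv]
    split_ifs <;> omega
  · intro m
    have h1 := hbu m
    have h2 := hbu' m
    rw [hu]
    split_ifs <;> omega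
  · intro m
    have h1 := hbu m
    have h2 := hbu' m
    rw [hwu]
    rcases eq_or_ne m (t + 1) with rfl | h8
    · simp
      omega
    · rcases eq_or_ne m (t + 2) with rfl | h9
      · simp
        omega
      · simp only [h8, h9, if_false, hu]
        split_ifs <;> omega

theorem f_eq_zero_of_tooFar {x y : V n k} (h : TooFar k x.1 y.1) : f x y = 0 := by
  have h1 := (not_tooFar_iff_weight x.card_eq y.card_eq).not.1 (not_not.2 h)
  rw [not_forall] at h1
  obtain ⟨m, hm⟩ := h1
  rw [not_and_or, not_le, not_le] at hm
  rcases hm with hm | hm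
  · obtain ⟨u, v, w, t, ht, hu0, hu1, hu2, hw0, hw1, hw2, hv, hw, h1, h2⟩ := exists_hop hm
    have h3 : Between x.1 w.1 y.1 := fun m => by
      have := h1 m
      have := h2 m
      omega
    have h4 : Between w.1 u.1 y.1 := fun m => by
      have := h1 m
      have := h2 m
      omega
    rw [f_eq_mul h3, f_eq_mul h4, f_eq_zero_of_left hw0 hw1 hw2 ht hw hv, zero_mul, mul_zero]
  · obtain ⟨u, v, w, t, ht, hu0, hu1, hu2, hw0, hw1, hw2, hv, hw, h1, h2⟩ := exists_hop hm
    rw [f_eq_mul h1, f_eq_mul h2, f_eq_zero_of_right hu0 hu1 hu2 ht hv hw, zero_mul, mul_zero]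

/-! ### The relations coming from generating intervals. -/

theorem X_smul_f_self (t : Fin n) (x : V n k) (h1 : t.1 ∉ x.1) (h2 : t.1 + 1 ∉ x.1) :
    (MvPolynomial.X t : PolyU n) • f x x = 0 := by
  have h : x.1 ∩ {t.1, t.1 + 1} = ∅ := by
    ext c
    simp only [Finset.mem_inter, Finset.mem_insert, Finset.mem_singleton, Finset.notMem_empty,
      iff_false]
    rintro ⟨h, rfl | rfl⟩ <;> contradiction
  have h3 := RingQuot.mkAlgHom_rel (PolyU n) (BRel.U t x h)
  rw [map_smul, map_zero] at h3
  exact h3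

/-- Let `u` be `x` with the particles at `j + 1, …, t` shifted left by one. The detour through `u`
costs `U_{j+1} ⋯ U_t`, and the remaining factor `U_{t+1}` kills the idempotent of `u`, since `u`
omits both `t` and `t + 1`. -/
theorem prod_X_smul_f_of_notMem {x y : V n k} {j : ℕ} (t : Fin n) (hjt : j ≤ t.1)
    (hj : j ∉ x.1) (ht : t.1 + 1 ∉ x.1) (hx : ∀ r, j < r → r ≤ t.1 → r ∈ x.1)
    (hxy : ∀ m, j < m → m ≤ t.1 + 1 → weight x.1 m = weight y.1 m) :
    (∏ s ∈ Finset.univ.filter (fun s : Fin n => j ≤ s.1 ∧ s.1 ≤ t.1),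
      (MvPolynomial.X s : PolyU n)) • f x y = 0 := by
  obtain ⟨u, hu⟩ : ∃ u : V n k, ∀ m, weight u.1 m =
      weight x.1 m - if j < m ∧ m ≤ t.1 then 1 else 0 := by
    refine V.exists_weight_eq _ ?_ ?_ ?_
    · rw [if_neg (by omega), x.weight_zero, Nat.sub_zero]
    · rw [x.weight_eq_zero (by omega), Nat.zero_sub]
    · intro m
      have h1 := weight_succ_le x.1 m
      have h2 := weight_le_succ x.1 m
      by_cases h3 : j < m ∧ m ≤ t.1
      · have h4 := weight_of_mem (hx m h3.1 h3.2)
        by_cases h5 : m + 1 ≤ t.1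
        · have h6 := weight_of_mem (hx (m + 1) (by omega) h5)
          rw [if_pos h3, if_pos (by omega)]
          omega
        · rw [if_pos h3, if_neg (by omega)]
          omega
      · by_cases h5 : j < m + 1 ∧ m + 1 ≤ t.1
        · obtain rfl : m = j := by omega
          have h6 := weight_of_notMem hj
          rw [if_neg h3, if_pos h5]
          omega
        · rw [if_neg h3, if_neg h5]
          omega
  have hpos : ∀ m, j < m → m ≤ t.1 → 1 ≤ weight x.1 m := fun m h1 h2 => by
    have := weight_of_mem (hx m h1 h2)
    omega
  have hut : t.1 ∉ u.1 := by
    rw [mem_iff_weight, hu, hu, if_neg (show ¬ (j < t.1 + 1 ∧ t.1 + 1 ≤ t.1) by omega)]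
    rcases hjt.lt_or_eq with h | h
    · have := weight_of_mem (hx t.1 h le_rfl)
      rw [if_pos ⟨h, le_rfl⟩]
      omega
    · have := weight_of_notMem hj
      rw [if_neg (by omega), ← h]
      omega
  have hut' : t.1 + 1 ∉ u.1 := by
    have := weight_of_notMem ht
    rw [mem_iff_weight, hu, hu, if_neg (by omega), if_neg (by omega)]
    omega
  have h1 : gMonomial n x.1 u.1 y.1
      = ∏ s ∈ Finset.univ.filter (fun s : Fin n => j ≤ s.1 ∧ s.1 < t.1), MvPolynomial.X s := by
    unfold gMonomial
    rw [Finset.prod_filter]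
    refine Finset.prod_congr rfl fun s _ => ?_
    have h2 := two_mul_gExp x.1 u.1 y.1 (s.1 + 1)
    simp only [twoW_eq_max_sub_min] at h2
    have h3 := hu (s.1 + 1)
    split_ifs with h4
    · rw [if_pos (by omega)] at h3
      have := hxy (s.1 + 1) (by omega) (by omega)
      have := hpos (s.1 + 1) (by omega) (by omega)
      rw [show gExp x.1 u.1 y.1 (s.1 + 1) = 1 by omega, pow_one]
    · rw [if_neg (by omega)] at h3
      rw [show gExp x.1 u.1 y.1 (s.1 + 1) = 0 by omega, pow_zero]
  have h2 : Finset.univ.filter (fun s : Fin n => j ≤ s.1 ∧ s.1 ≤ t.1)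
      = insert t (Finset.univ.filter (fun s : Fin n => j ≤ s.1 ∧ s.1 < t.1)) := by
    ext s
    simp only [Finset.mem_filter, Finset.mem_univ, true_and, Finset.mem_insert, Fin.ext_iff]
    omega
  have h3 : f x u = f x u * f u u := by rw [f_mul_f, gMonomial_right, one_smul]
  rw [h2, Finset.prod_insert (by simp), ← h1, mul_smul, ← f_mul_f, h3, ← smul_mul_assoc,
    ← mul_smul_comm, X_smul_f_self t u hut hut', mul_zero, zero_mul]

/-- The regions `j` and `t + 1` may be missing from different states. The arrow factors through a
state lying between `x` and `y` that misses both, to which the previous case applies. -/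
theorem prod_X_smul_f {x y : V n k} {j : ℕ} (t : Fin n) (hjt : j ≤ t.1)
    (hj : j ∉ x.1 ∩ y.1) (ht : t.1 + 1 ∉ x.1 ∩ y.1)
    (hxy' : ∀ r, j < r → r ≤ t.1 → r ∈ x.1 ∩ y.1)
    (hxy : ∀ m, j < m → m ≤ t.1 + 1 → weight x.1 m = weight y.1 m) :
    (∏ s ∈ Finset.univ.filter (fun s : Fin n => j ≤ s.1 ∧ s.1 ≤ t.1),
      (MvPolynomial.X s : PolyU n)) • f x y = 0 := by
  obtain ⟨p, hp, hpj⟩ : ∃ p, (p = x ∨ p = y) ∧ j ∉ p.1 := by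
    rw [Finset.mem_inter, not_and_or] at hj
    rcases hj with h | h
    · exact ⟨x, Or.inl rfl, h⟩
    · exact ⟨y, Or.inr rfl, h⟩
  obtain ⟨q, hq, hqt⟩ : ∃ q, (q = x ∨ q = y) ∧ t.1 + 1 ∉ q.1 := by
    rw [Finset.mem_inter, not_and_or] at ht
    rcases ht with h | h
    · exact ⟨x, Or.inl rfl, h⟩
    · exact ⟨y, Or.inr rfl, h⟩
  have hpq : weight p.1 (j + 1) = weight q.1 (j + 1) := by
    have := hxy (j + 1) (by omega) (by omega)
    rcases hp with rfl | rfl <;> rcases hq with rfl | rfl <;> omega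
  -- Glue `p` to the left of line `j + 1` with `q` from that line on; the weights of `p` and `q`
  -- agree there.
  obtain ⟨u, hu⟩ : ∃ u : V n k, ∀ m, weight u.1 m =
      if m ≤ j then weight p.1 m else weight q.1 m := by
    refine V.exists_weight_eq _ ?_ ?_ ?_
    · simp [p.weight_zero]
    · rw [if_neg (by omega), q.weight_eq_zero (by omega)]
    · intro m
      have h1 := weight_succ_le p.1 m
      have h2 := weight_le_succ p.1 m
      have h3 := weight_succ_le q.1 m
      have h4 := weight_le_succ q.1 m
      rcases lt_trichotomy m j with h | rfl | h
      · rw [if_pos (by omega), if_pos (by omega)]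
        omega
      · rw [if_pos le_rfl, if_neg (by omega)]
        omega
      · rw [if_neg (by omega), if_neg (by omega)]
        omega
  have hb : Between x.1 u.1 y.1 := fun m => by
    rw [hu]
    rcases hp with rfl | rfl <;> rcases hq with rfl | rfl <;> split_ifs <;> omega
  rw [f_eq_mul hb, ← mul_smul_comm, prod_X_smul_f_of_notMem t hjt, mul_zero]
  · have := weight_of_notMem hpj
    rw [mem_iff_weight, hu, hu, if_pos le_rfl, if_neg (by omega)]
    omega
  · have := weight_of_notMem hqt
    rw [mem_iff_weight, hu, hu, if_neg (by omega), if_neg (by omega)]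
    omega
  · intro r h1 h2
    have h3 := Finset.mem_inter.1 (hxy' r h1 h2)
    have h4 : r ∈ q.1 := by
      rcases hq with rfl | rfl
      exacts [h3.1, h3.2]
    have := weight_of_mem h4
    rw [mem_iff_weight, hu, hu, if_neg (by omega), if_neg (by omega)]
    omega
  · intro m h1 h2
    have := hxy m h1 h2
    rw [hu, if_neg (by omega)]
    rcases hq with rfl | rfl <;> omega

/-! ### Restriction to the variables to the right of a state -/


theorem nthElem_mem (z : Vl n k) (i : Fin k) : nthElem z.1 i.1 ∈ z.1 := by
  have hi : i.1 < z.1.card := by rw [z.card_eq]; exact i.2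
  have h1 := (nthElem_lt_iff z.1 hi (nthElem z.1 i.1 + 1)).1 (by omega)
  have h2 := (nthElem_lt_iff z.1 hi (nthElem z.1 i.1)).not.1 (by omega)
  by_contra h
  have := weight_of_notMem h
  omega

theorem nthElem_injective (z : Vl n k) : Function.Injective fun i : Fin k => nthElem z.1 i.1 := by
  intro i j hij
  simp only at hij
  have hc := z.card_eq
  have h1 := nthElem_mem z i
  have h2 := weight_of_mem h1
  have e : ∀ l : Fin k, nthElem z.1 l.1 = nthElem z.1 i.1 →
      l.1 + weight z.1 (nthElem z.1 i.1) = k := by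
    intro l hl
    have h3 := (nthElem_lt_iff z.1 (i := l.1) (by omega) (nthElem z.1 i.1 + 1)).1 (by omega)
    have h4 := (nthElem_lt_iff z.1 (i := l.1) (by omega) (nthElem z.1 i.1)).not.1 (by omega)
    omega
  have h3 := e i rfl
  have h4 := e j hij.symm
  exact Fin.ext (by omega)

/-- The embedding listing the elements of a left state. -/
noncomputable def nthEmb (z : Vl n k) : Fin k ↪ Fin n where
  toFun i := ⟨nthElem z.1 i.1, nthElem_lt z i⟩
  inj' _ _ h := nthElem_injective z (Fin.ext_iff.1 h)

theorem mem_range_nthEmb (z : Vl n k) (t : Fin n) : t ∈ Set.range (nthEmb z) ↔ t.1 ∈ z.1 := by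
  constructor
  · rintro ⟨i, rfl⟩
    exact nthElem_mem z i
  · intro h
    have h1 : Finset.univ.map ((nthEmb z).trans Fin.valEmbedding) = z.1 := by
      refine Finset.eq_of_subset_of_card_le ?_ ?_
      · intro a ha
        obtain ⟨i, _, rfl⟩ := Finset.mem_map.1 ha
        exact nthElem_mem z i
      · rw [z.card_eq, Finset.card_map, Finset.card_univ, Fintype.card_fin]
    rw [← h1] at h
    obtain ⟨i, _, hi⟩ := Finset.mem_map.1 h
    exact ⟨i, Fin.ext hi⟩

open Classical in
/-- The ring homomorphism `ℤ[U_1, …, U_n] → ℤ[t_1, …, t_k]` sending `U_{z_i + 1}` to `t_i` and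
the other variables to zero. -/
noncomputable def restrictTo (z : Vl n k) : PolyU n →ₐ[ℤ] MvPolynomial (Fin k) ℤ :=
  MvPolynomial.aeval fun t =>
    if h : t ∈ Set.range (nthEmb z) then MvPolynomial.X h.choose else 0

theorem restrictTo_X_nthEmb (z : Vl n k) (i : Fin k) :
    restrictTo z (MvPolynomial.X (nthEmb z i)) = MvPolynomial.X i := by
  unfold restrictTo
  have h : nthEmb z i ∈ Set.range (nthEmb z) := ⟨i, rfl⟩
  rw [MvPolynomial.aeval_X, dif_pos h]
  congr 1
  exact (nthEmb z).injective h.choose_spec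

theorem restrictTo_X_of_notMem (z : Vl n k) {t : Fin n} (h : t.1 ∉ z.1) :
    restrictTo z (MvPolynomial.X t) = 0 := by
  unfold restrictTo
  rw [MvPolynomial.aeval_X, dif_neg]
  rwa [mem_range_nthEmb]

/-- The section of `restrictTo z` sending `t_i` to `U_{z_i + 1}`. -/
noncomputable def extendFrom (z : Vl n k) : MvPolynomial (Fin k) ℤ →ₐ[ℤ] PolyU n :=
  MvPolynomial.aeval fun i => MvPolynomial.X (nthEmb z i)

theorem restrictTo_extendFrom (z : Vl n k) (p : MvPolynomial (Fin k) ℤ) :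
    restrictTo z (extendFrom z p) = p := by
  have h : (restrictTo z).comp (extendFrom z) = AlgHom.id ℤ _ := by
    ext i
    simp [extendFrom, restrictTo_X_nthEmb]
  exact DFunLike.congr_fun h p

/-- Modulo these variables, restricting and extending back is the identity on generators, so a
polynomial is congruent to the extension of its restriction. -/
theorem mem_span_of_restrictTo_eq_zero (z : Vl n k) {p : PolyU n} (hp : restrictTo z p = 0) :
    p ∈ Ideal.span {q : PolyU n | ∃ t : Fin n, t.1 ∉ z.1 ∧ q = MvPolynomial.X t} := by
  have h : (Ideal.Quotient.mkₐ ℤ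
      (Ideal.span {q : PolyU n | ∃ t : Fin n, t.1 ∉ z.1 ∧ q = MvPolynomial.X t})).comp
      ((extendFrom z).comp (restrictTo z)) = Ideal.Quotient.mkₐ ℤ _ := by
    refine MvPolynomial.algHom_ext fun t => ?_
    by_cases ht : t.1 ∈ z.1
    · obtain ⟨i, rfl⟩ := (mem_range_nthEmb z t).2 ht
      simp only [AlgHom.comp_apply]
      rw [restrictTo_X_nthEmb]
      simp [extendFrom]
    · simp only [AlgHom.comp_apply]
      rw [restrictTo_X_of_notMem z ht, map_zero, map_zero]
      have hm : (MvPolynomial.X t : PolyU n) ∈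
          Ideal.span {q : PolyU n | ∃ t : Fin n, t.1 ∉ z.1 ∧ q = MvPolynomial.X t} :=
        Ideal.subset_span ⟨t, ht, rfl⟩
      exact (Ideal.Quotient.eq_zero_iff_mem.2 hm).symm
  have h1 := DFunLike.congr_fun h p
  simp only [AlgHom.comp_apply] at h1
  rw [hp, map_zero, map_zero] at h1
  exact Ideal.Quotient.eq_zero_iff_mem.1 h1.symm

theorem restrictTo_esymm (z : Vl n k) (m : ℕ) :
    restrictTo z (MvPolynomial.esymm (Fin n) ℤ m) = MvPolynomial.esymm (Fin k) ℤ m := by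
  unfold MvPolynomial.esymm
  rw [map_sum, ← Finset.sum_subset (Finset.powersetCard_mono
    (Finset.subset_univ (Finset.univ.map (nthEmb z)))), Finset.powersetCard_map, Finset.sum_map]
  · refine Finset.sum_congr rfl fun s _ => ?_
    rw [map_prod]
    simp [Finset.prod_map, restrictTo_X_nthEmb]
  · intro s hs hs'
    rw [map_prod]
    have h : ∃ t ∈ s, t.1 ∉ z.1 := by
      by_contra! h
      apply hs'
      rw [Finset.mem_powersetCard] at hs ⊢
      refine ⟨fun t ht => ?_, hs.2⟩
      obtain ⟨i, rfl⟩ := (mem_range_nthEmb z t).2 (h t ht)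
      exact Finset.mem_map_of_mem _ (Finset.mem_univ i)
    obtain ⟨t, ht, ht'⟩ := h
    exact Finset.prod_eq_zero ht (restrictTo_X_of_notMem z ht')

/-- The homomorphism `S → ℤ[t_1, …, t_k]` sending `ε_i` to the elementary symmetric polynomial. -/
noncomputable def symmHom (k : ℕ) : S k →+* MvPolynomial (Fin k) ℤ :=
  (MvPolynomial.aeval fun i : Fin k => MvPolynomial.esymm (Fin k) ℤ (i.1 + 1) :
    MvPolynomial (Fin k) ℤ →ₐ[ℤ] MvPolynomial (Fin k) ℤ).toRingHom

theorem restrictTo_epsHom (z : Vl n k) (s : S k) : restrictTo z (epsHom n k s) = symmHom k s := by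
  have h : (restrictTo z).comp
      (MvPolynomial.aeval fun i : Fin k => MvPolynomial.esymm (Fin n) ℤ (i.1 + 1))
      = MvPolynomial.aeval fun i : Fin k => MvPolynomial.esymm (Fin k) ℤ (i.1 + 1) := by
    refine MvPolynomial.algHom_ext fun i => ?_
    rw [AlgHom.comp_apply, MvPolynomial.aeval_X, MvPolynomial.aeval_X, restrictTo_esymm]
  exact DFunLike.congr_fun h s

/-! ### The representation of `B(n,k)` attached to a left state -/

theorem weight_congr {x y : Finset ℕ} {m : ℕ} (h : ∀ r, m ≤ r → (r ∈ x ↔ r ∈ y)) :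
    weight x m = weight y m := by
  unfold weight
  congr 1
  ext r
  simp only [Finset.mem_filter]
  constructor
  · rintro ⟨h1, h2⟩
    exact ⟨(h r h2).1 h1, h2⟩
  · rintro ⟨h1, h2⟩
    exact ⟨(h r h2).2 h1, h2⟩

/-- The hop changes the weight on line `t + 1`, whereas at a hole `t` of `z` all states near `z`
have the same weight there. -/
theorem mem_of_near_of_hop {x y z : Finset ℕ} {t : ℕ} (hx : Near z x) (hy : Near z y)
    (h1 : t + 1 ∉ x) (h2 : t + 1 ∈ y) (h : ∀ r, t + 2 ≤ r → (r ∈ x ↔ r ∈ y)) : t ∈ z := by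
  by_contra ht
  have h3 := hx t ht
  have h4 := hy t ht
  have h5 := weight_of_notMem h1
  have h6 := weight_of_mem h2
  have h7 : weight x (t + 1 + 1) = weight y (t + 1 + 1) := weight_congr h
  omega

/-- Three states related by hops over two consecutive lines are not near a common state. -/
theorem not_near_of_hops {x y w z : Finset ℕ} {t : ℕ} (hx : Near z x) (hy : Near z y)
    (hw : Near z w) (hc : y.card = z.card) (h1 : t + 1 ∉ x) (h2 : t ∉ y) (h3 : t + 1 ∈ y)
    (h4 : t + 2 ∉ y) (h5 : t + 2 ∈ w) (hxy : ∀ r, t + 2 ≤ r → (r ∈ x ↔ r ∈ y))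
    (hyw : ∀ r, t + 3 ≤ r → (r ∈ y ↔ r ∈ w)) : False :=
  -- The two hops put `t` and `t + 1` into `z`; since `y` misses `t`, it must then contain `t + 2`.
  h4 (hy.mem_of_notMem hc (mem_of_near_of_hop hx hy h1 h3 hxy)
    (mem_of_near_of_hop hy hw h4 h5 hyw) h2)

/-- Both sides have exponents `w^{x,y} + w^{y,w} + w^{w,v} - w^{x,v}`. The identity allows arrows to
be rescaled by `g^{x,·,·}` for a base point `x` and remain multiplicative. -/
theorem gMonomial_cocycle (x y w v : Finset ℕ) :
    gMonomial n x y w * gMonomial n x w v = gMonomial n y w v * gMonomial n x y v := by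
  unfold gMonomial
  rw [← Finset.prod_mul_distrib, ← Finset.prod_mul_distrib]
  refine Finset.prod_congr rfl fun t _ => ?_
  rw [← pow_add, ← pow_add]
  congr 1
  have h1 := two_mul_gExp x y w (t.1 + 1)
  have h2 := two_mul_gExp x w v (t.1 + 1)
  have h3 := two_mul_gExp y w v (t.1 + 1)
  have h4 := two_mul_gExp x y v (t.1 + 1)
  omega

/-- The coefficient ring of the representation attached to `z`. -/
abbrev RestrictedPoly (z : Vl n k) : Type := PolyU n ⧸ RingHom.ker (restrictTo z)

/-- Some hole `h` of `z` detects that `w` is not near. There `y` and `v` agree on line `h + 1` while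
`w` differs, so `U_{h+1}`, which is zero in the quotient, divides the monomial. -/
theorem mk_gMonomial_eq_zero (z : Vl n k) {y w v : Finset ℕ} (hy : Near z.1 y) (hv : Near z.1 v)
    (hw : ¬ Near z.1 w) (hyn : y ⊆ Finset.range (n + 1)) (hwn : w ⊆ Finset.range (n + 1)) :
    (Ideal.Quotient.mk (RingHom.ker (restrictTo z)) (gMonomial n y w v)) = 0 := by
  unfold Near at hw
  push Not at hw
  obtain ⟨h, hz, hne⟩ := hw
  have h1 := hy h hz
  have h2 := hv h hz
  have hn : h < n := by
    by_contra! hn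
    rw [← h1, weight_eq_zero hyn (by omega), weight_eq_zero hwn (by omega)] at hne
    exact hne rfl
  rw [Ideal.Quotient.eq_zero_iff_mem, RingHom.mem_ker]
  unfold gMonomial
  rw [map_prod]
  refine Finset.prod_eq_zero (Finset.mem_univ ⟨h, hn⟩) ?_
  rw [map_pow, restrictTo_X_of_notMem z hz, zero_pow]
  have h3 := two_mul_gExp y w v (h + 1)
  simp only [twoW_eq_max_sub_min] at h3
  simp only
  omega

open Classical in
/-- The matrix of the arrow `y → w` in the representation attached to `z`, with base point `x`. -/
noncomputable def arrowMatrix (z : Vl n k) (x : V n k) (p : V n k × V n k) :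
    Matrix {y : V n k // Near z.1 y.1} {y : V n k // Near z.1 y.1} (RestrictedPoly z) :=
  Matrix.of fun a b => if a.1 = p.1 ∧ b.1 = p.2 then
    Ideal.Quotient.mk _ (gMonomial n x.1 p.1.1 p.2.1) else 0

open Classical in
/-- The representation of the free algebra on the arrows. -/
noncomputable def arrowRep (z : Vl n k) (x : V n k) : ArrowAlg n k →ₐ[PolyU n]
    Matrix {y : V n k // Near z.1 y.1} {y : V n k // Near z.1 y.1} (RestrictedPoly z) :=
  FreeAlgebra.lift (PolyU n) (arrowMatrix z x)

theorem arrowRep_arrow (z : Vl n k) (x y w : V n k) :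
    arrowRep z x (arrow y w) = arrowMatrix z x (y, w) := by
  classical
  unfold arrowRep arrow
  rw [FreeAlgebra.lift_ι_apply]

/-- Composition through a state near `z` is the cocycle identity. Through any other state the matrix
product is zero, and the structure constant vanishes in the coefficient ring. -/
theorem arrowRep_rel (z : Vl n k) (x : V n k) ⦃a b : ArrowAlg n k⦄
    (h : B0Rel n k a b) : arrowRep z x a = arrowRep z x b := by
  classical
  induction h with
  | one =>
    rw [map_sum, map_one]
    ext a b
    rw [Matrix.sum_apply, Finset.sum_eq_single a.1]
    · rw [arrowRep_arrow, Matrix.one_apply]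
      simp only [arrowMatrix, Matrix.of_apply, true_and, gMonomial_right, map_one]
      simp only [Subtype.ext_iff, eq_comm]
    · intro c _ hc
      rw [arrowRep_arrow]
      simp [arrowMatrix, hc.symm]
    · intro h
      exact absurd (Finset.mem_univ _) h
  | not_composable y w u v h =>
    rw [map_mul, map_zero, arrowRep_arrow, arrowRep_arrow]
    ext a b
    rw [Matrix.mul_apply, Matrix.zero_apply]
    refine Finset.sum_eq_zero fun c _ => ?_
    simp only [arrowMatrix, Matrix.of_apply]
    by_cases hc : c.1 = w
    · rw [if_neg (c := c.1 = u ∧ b.1 = v) (fun h' => h (hc.symm.trans h'.1)), mul_zero]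
    · rw [if_neg (fun h' => hc h'.2), zero_mul]
  | comp y w v =>
    rw [map_mul, map_smul, arrowRep_arrow, arrowRep_arrow, arrowRep_arrow]
    ext a b
    rw [Matrix.mul_apply, Matrix.smul_apply]
    simp only [arrowMatrix, Matrix.of_apply]
    by_cases hab : a.1 = y ∧ b.1 = v
    · obtain ⟨rfl, rfl⟩ := hab
      simp only [true_and, and_self, and_true, if_true]
      rw [Algebra.smul_def, Ideal.Quotient.algebraMap_eq, ← map_mul, ← gMonomial_cocycle, map_mul]
      by_cases hw : Near z.1 w.1
      · rw [Finset.sum_eq_single ⟨w, hw⟩]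
        · simp
        · intro c _ hc
          rw [if_neg (fun h' => hc (Subtype.ext h')), zero_mul]
        · intro h
          exact absurd (Finset.mem_univ _) h
      · rw [← map_mul, gMonomial_cocycle, map_mul,
          mk_gMonomial_eq_zero z a.2 b.2 hw a.1.subset_range w.subset_range, zero_mul]
        refine Finset.sum_eq_zero fun c _ => ?_
        rw [if_neg, zero_mul]
        rintro rfl
        exact hw c.2
    · rw [if_neg hab, smul_zero]
      refine Finset.sum_eq_zero fun c _ => ?_
      by_cases ha : a.1 = y
      · rw [if_neg (c := c.1 = w ∧ b.1 = v) (fun h' => hab ⟨ha, h'.2⟩), mul_zero]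
      · rw [if_neg (fun h' => ha h'.1), zero_mul]

open Classical in
/-- The representation of `B_0(n,k)` attached to `z`. -/
noncomputable def rep0 (z : Vl n k) (x : V n k) : B0 n k →ₐ[PolyU n]
    Matrix {y : V n k // Near z.1 y.1} {y : V n k // Near z.1 y.1} (RestrictedPoly z) :=
  RingQuot.liftAlgHom (PolyU n) ⟨arrowRep z x, arrowRep_rel z x⟩

theorem rep0_f0 (z : Vl n k) (x : V n k) (y w : V n k) :
    rep0 z x (f0 y w) = arrowMatrix z x (y, w) := by
  classical
  rw [← arrowRep_arrow]
  exact RingQuot.liftAlgHom_mkAlgHom_apply _ _ _ _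

open Classical in
theorem rep0_sum_ite (z : Vl n k) (x : V n k) (P : V n k → V n k → Prop)
    [∀ y w, Decidable (P y w)]
    (a b : {y : V n k // Near z.1 y.1}) (h : ¬ P a.1 b.1) :
    rep0 z x (∑ y : V n k, ∑ w : V n k, if P y w then f0 y w else 0) a b = 0 := by
  rw [map_sum, Matrix.sum_apply]
  refine Finset.sum_eq_zero fun y _ => ?_
  rw [map_sum, Matrix.sum_apply]
  refine Finset.sum_eq_zero fun w _ => ?_
  split_ifs with hP
  · rw [rep0_f0]
    simp only [arrowMatrix, Matrix.of_apply]
    rw [if_neg]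
    rintro ⟨rfl, rfl⟩
    exact h hP
  · simp

theorem rep0_elemR (z : Vl n k) (x : V n k) (t : ℕ)
    (a b : {y : V n k // Near z.1 y.1})
    (h : ¬ (a.1.1 ∩ {t, t + 1} = {t} ∧ b.1.1 = (a.1.1 \ {t}) ∪ {t + 1})) :
    rep0 z x (elemR n k t) a b = 0 :=
  rep0_sum_ite z x (fun y w => y.1 ∩ {t, t + 1} = {t} ∧ w.1 = (y.1 \ {t}) ∪ {t + 1}) a b h

theorem rep0_elemL (z : Vl n k) (x : V n k) (t : ℕ)
    (a b : {y : V n k // Near z.1 y.1})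
    (h : ¬ (a.1.1 ∩ {t, t + 1} = {t + 1} ∧ b.1.1 = (a.1.1 \ {t + 1}) ∪ {t})) :
    rep0 z x (elemL n k t) a b = 0 :=
  rep0_sum_ite z x (fun y w => y.1 ∩ {t, t + 1} = {t + 1} ∧ w.1 = (y.1 \ {t + 1}) ∪ {t}) a b h

theorem mem_of_inter_pair_eq {x : Finset ℕ} {t : ℕ} (h : x ∩ {t, t + 1} = {t}) :
    t ∈ x ∧ t + 1 ∉ x := by
  constructor
  · exact (Finset.mem_inter.1 (h ▸ Finset.mem_singleton_self t)).1
  · intro h'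
    have : t + 1 ∈ x ∩ {t, t + 1} := by simp [h']
    rw [h] at this
    simp at this

theorem mem_of_inter_pair_eq' {x : Finset ℕ} {t : ℕ} (h : x ∩ {t, t + 1} = {t + 1}) :
    t ∉ x ∧ t + 1 ∈ x := by
  constructor
  · intro h'
    have : t ∈ x ∩ {t, t + 1} := by simp [h']
    rw [h] at this
    simp at this
  · exact (Finset.mem_inter.1 (h ▸ Finset.mem_singleton_self (t + 1))).1

/-- No three states in a row of two consecutive hops are all near `z`. If a state near `z` omits `t`
and `t + 1`, then `t ∉ z`, so `U_{t+1}` already acts as zero. -/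
theorem rep0_rel (z : Vl n k) (x : V n k) ⦃a b : B0 n k⦄
    (h : BRel n k a b) : rep0 z x a = rep0 z x b := by
  classical
  induction h with
  | RR t ht =>
    rw [map_mul, map_zero]
    ext a b
    rw [Matrix.mul_apply, Matrix.zero_apply]
    refine Finset.sum_eq_zero fun c _ => ?_
    by_cases h1 : a.1.1 ∩ {t, t + 1} = {t} ∧ c.1.1 = (a.1.1 \ {t}) ∪ {t + 1}
    · by_cases h2 : c.1.1 ∩ {t + 1, t + 1 + 1} = {t + 1} ∧
          b.1.1 = (c.1.1 \ {t + 1}) ∪ {t + 1 + 1}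
      · exfalso
        obtain ⟨h3, h4⟩ := mem_of_inter_pair_eq h1.1
        obtain ⟨h5, h6⟩ := mem_of_inter_pair_eq h2.1
        refine not_near_of_hops a.2 c.2 b.2 (c.1.card_eq.trans z.card_eq.symm) h4 ?_ h5 h6 ?_ ?_ ?_
        · simp [h1.2]
        · simp [h2.2]
        · intro r hr
          simp [h1.2, show r ≠ t by omega, show r ≠ t + 1 by omega]
        · intro r hr
          simp [h2.2, show r ≠ t + 1 by omega, show r ≠ t + 1 + 1 by omega]
      · rw [rep0_elemR z x _ c b h2, mul_zero]
    · rw [rep0_elemR z x _ a c h1, zero_mul]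
  | LL t ht =>
    rw [map_mul, map_zero]
    ext a b
    rw [Matrix.mul_apply, Matrix.zero_apply]
    refine Finset.sum_eq_zero fun c _ => ?_
    by_cases h1 : a.1.1 ∩ {t + 1, t + 1 + 1} = {t + 1 + 1} ∧
        c.1.1 = (a.1.1 \ {t + 1 + 1}) ∪ {t + 1}
    · by_cases h2 : c.1.1 ∩ {t, t + 1} = {t + 1} ∧ b.1.1 = (c.1.1 \ {t + 1}) ∪ {t}
      · exfalso
        obtain ⟨h3, h4⟩ := mem_of_inter_pair_eq' h1.1
        obtain ⟨h5, h6⟩ := mem_of_inter_pair_eq' h2.1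
        refine not_near_of_hops b.2 c.2 a.2 (c.1.card_eq.trans z.card_eq.symm) ?_ h5 h6 ?_ h4 ?_ ?_
        · simp [h2.2]
        · simp [h1.2]
        · intro r hr
          simp [h2.2, show r ≠ t by omega, show r ≠ t + 1 by omega]
        · intro r hr
          simp [h1.2, show r ≠ t + 1 by omega, show r ≠ t + 1 + 1 by omega]
      · rw [rep0_elemL z x _ c b h2, mul_zero]
    · rw [rep0_elemL z x _ a c h1, zero_mul]
  | U t y h =>
    rw [map_smul, map_zero, rep0_f0]
    ext a b
    rw [Matrix.smul_apply, Matrix.zero_apply]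
    simp only [arrowMatrix, Matrix.of_apply]
    split_ifs with hab
    · obtain ⟨rfl, -⟩ := hab
      rw [Algebra.smul_def, Ideal.Quotient.algebraMap_eq]
      have ht : t.1 ∉ z.1 := by
        intro ht
        rcases a.2.mem_or_mem (a.1.card_eq.trans z.card_eq.symm) ht with h1 | h1
        · have : t.1 ∈ a.1.1 ∩ {t.1, t.1 + 1} := by simp [h1]
          simp [h] at this
        · have : t.1 + 1 ∈ a.1.1 ∩ {t.1, t.1 + 1} := by simp [h1]
          simp [h] at this
      rw [Ideal.Quotient.eq_zero_iff_mem.2 (RingHom.mem_ker.2 (restrictTo_X_of_notMem z ht)),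
        zero_mul]
    · exact smul_zero _

open Classical in
/-- The representation of `B(n,k)` attached to `z`, with base point `x`. -/
noncomputable def rep (z : Vl n k) (x : V n k) : B n k →ₐ[PolyU n]
    Matrix {y : V n k // Near z.1 y.1} {y : V n k // Near z.1 y.1} (RestrictedPoly z) :=
  RingQuot.liftAlgHom (PolyU n) ⟨rep0 z x, rep0_rel z x⟩

theorem rep_f (z : Vl n k) (x : V n k) (y w : V n k) :
    rep z x (f y w) = arrowMatrix z x (y, w) := by
  classical
  rw [← rep0_f0 z x]
  exact RingQuot.liftAlgHom_mkAlgHom_apply _ _ _ _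

open Classical in
/-- Reading off the coefficient of `f_{x,y}` modulo the variables that vanish near `z`. -/
theorem exists_coefficient (z : Vl n k) {x y : V n k} (hx : Near z.1 x.1) (hy : Near z.1 y.1) :
    ∃ Λ : B n k →ₗ[PolyU n] RestrictedPoly z,
      ∀ u v : V n k, Λ (f u v) = if u = x ∧ v = y then 1 else 0 := by
  -- Choosing the base point equal to the row index `x` makes the entry of `f_{x,y}` equal to
  -- `g^{x,x,y} = 1`.
  refine ⟨(Matrix.entryLinearMap (PolyU n) (RestrictedPoly z) ⟨x, hx⟩ ⟨y, hy⟩).comp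
    (rep z x).toLinearMap, fun u v => ?_⟩
  rw [LinearMap.comp_apply, AlgHom.toLinearMap_apply, rep_f, Matrix.entryLinearMap_apply]
  simp only [arrowMatrix, Matrix.of_apply]
  by_cases huv : u = x ∧ v = y
  · obtain ⟨rfl, rfl⟩ := huv
    simp [gMonomial_left]
  · rw [if_neg huv, if_neg]
    rintro ⟨h1, h2⟩
    exact huv ⟨h1.symm, h2.symm⟩

/-! ### The staircase basis of the polynomial ring over the symmetric polynomials -/

section Staircase

open Polynomial

/-- If `C` is generated over `A` by the roots of a monic polynomial over `A`, then the staircase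
monomials in these roots span `C` over `A`. -/
theorem span_staircase_eq_top (k : ℕ) : ∀ (A C : Type) [CommRing A] [CommRing C] [Nontrivial C]
    [Algebra A C] (t : Fin k → C) (P : A[X]), P.Monic →
    P.map (algebraMap A C) = ∏ i, (X - Polynomial.C (t i)) →
    Algebra.adjoin A (Set.range t) = ⊤ →
    Submodule.span A {x : C | ∃ c : Fin k → ℕ, (∀ i, c i + i.1 < k) ∧ x = ∏ i, t i ^ c i} = ⊤ := by
  induction k with
  | zero =>
    intro A C _ _ _ _ t P _ _ hgen
    rw [eq_top_iff]
    rintro x -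
    have hx : x ∈ Algebra.adjoin A (Set.range t) := hgen ▸ Algebra.mem_top
    rw [Set.range_eq_empty, Algebra.adjoin_empty] at hx
    obtain ⟨a, rfl⟩ := Algebra.mem_bot.1 hx
    rw [Algebra.algebraMap_eq_smul_one]
    exact Submodule.smul_mem _ _ (Submodule.subset_span ⟨0, fun i => i.elim0, by simp⟩)
  | succ k ih =>
    intro A C _ _ _ _ t P hP hmap hgen
    classical
    have hdeg : P.natDegree = k + 1 := by
      rw [← hP.natDegree_map (algebraMap A C), hmap, natDegree_finsetProd_X_sub_C_eq_card,
        Finset.card_univ, Fintype.card_fin]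
    -- Adjoin one root: `A'` is spanned over `A` by `1, t_0, …, t_0^k`, and dividing `P` by `X -
    -- t_0` leaves a monic polynomial over `A'` with the other `k` roots.
    set A' := Algebra.adjoin A {t 0} with hA'
    let a : A' := ⟨t 0, Algebra.subset_adjoin rfl⟩
    have ha : algebraMap A' C a = t 0 := rfl
    have hmap' : (P.map (algebraMap A A')).map (algebraMap A' C) = ∏ i, (X - Polynomial.C (t i)) := by
      rw [Polynomial.map_map, ← IsScalarTower.algebraMap_eq, hmap]
    have hinj : Function.Injective (algebraMap A' C) := Subtype.val_injective
    have hroot : (P.map (algebraMap A A')).IsRoot a := by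
      apply hinj
      rw [map_zero, ← Polynomial.eval_map_apply, hmap', ha, Polynomial.eval_prod]
      exact Finset.prod_eq_zero (Finset.mem_univ 0) (by simp)
    have hQ := mul_divByMonic_eq_iff_isRoot.2 hroot
    have hQm : (P.map (algebraMap A A') /ₘ (X - Polynomial.C a)).Monic :=
      (monic_X_sub_C a).of_mul_monic_left (hQ.symm ▸ hP.map _)
    have hQmap : (P.map (algebraMap A A') /ₘ (X - Polynomial.C a)).map (algebraMap A' C)
        = ∏ i : Fin k, (X - Polynomial.C (t i.succ)) := by
      refine (monic_X_sub_C (t 0)).isRegular.left ?_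
      have h := congrArg (Polynomial.map (algebraMap A' C)) hQ
      rw [hmap', Polynomial.map_mul, Fin.prod_univ_succ] at h
      simpa [ha] using h
    have hgen' : Algebra.adjoin A' (Set.range fun i : Fin k => t i.succ) = ⊤ := by
      rw [eq_top_iff]
      rintro x -
      have hx : x ∈ Algebra.adjoin A (Set.range t) := hgen ▸ Algebra.mem_top
      induction hx using Algebra.adjoin_induction with
      | mem x hx =>
        obtain ⟨i, rfl⟩ := hx
        refine Fin.cases ?_ (fun i => ?_) i
        · exact Subalgebra.algebraMap_mem _ a
        · exact Algebra.subset_adjoin ⟨i, rfl⟩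
      | algebraMap r =>
        rw [IsScalarTower.algebraMap_apply A A' C]
        exact Subalgebra.algebraMap_mem _ _
      | add x y _ _ hx hy => exact add_mem hx hy
      | mul x y _ _ hx hy => exact mul_mem hx hy
    have hspan := ih A' C (fun i => t i.succ) _ hQm hQmap hgen'
    have hA : Submodule.span A ((fun j => a ^ j) '' (Finset.range (k + 1) : Set ℕ)) = ⊤ := by
      have h1 := Submodule.span_range_natDegree_eq_adjoin (x := t 0) hP (by
        rw [aeval_def, ← eval_map, hmap, eval_prod]
        exact Finset.prod_eq_zero (Finset.mem_univ 0) (by simp))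
      have hval : Function.Injective (Submodule.map A'.val.toLinearMap) :=
        Submodule.map_injective_of_injective Subtype.val_injective
      apply hval
      rw [Submodule.map_span, ← Set.image_comp, Submodule.map_top]
      rw [hdeg, Finset.coe_image] at h1
      refine Eq.trans (Eq.trans ?_ h1) ?_
      · rfl
      · ext x
        simp [hA']
    have h2 := Submodule.span_smul_of_span_eq_top hA
      {x : C | ∃ c : Fin k → ℕ, (∀ i, c i + i.1 < k) ∧ x = ∏ i, t i.succ ^ c i}
    rw [hspan] at h2
    rw [eq_top_iff, ← Submodule.restrictScalars_top (S := A) (R := A'), ← h2]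
    refine Submodule.span_mono ?_
    rintro _ ⟨_, ⟨j, hj, rfl⟩, _, ⟨c, hc, rfl⟩, rfl⟩
    refine ⟨Fin.cons j c, fun i => ?_, ?_⟩
    · refine Fin.cases ?_ (fun i => ?_) i
      · simpa using hj
      · have := hc i
        simp
        omega
    · rw [Fin.prod_univ_succ]
      rfl

/-- The staircase monomials are linearly independent over the symmetric polynomials. -/
theorem staircase_independent {k : ℕ} {ι : Type*} (c : ι → Fin k → ℕ)
    (hc : ∀ a i, c a i + i.1 < k) (s : ι → MvPolynomial (Fin k) ℤ)
    (hs : ∀ a, (s a).IsSymmetric) (m : ℕ) (hm : m ≤ k) : ∀ F : Finset ι,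
    (∀ a ∈ F, ∀ b ∈ F, (∀ i : Fin k, i.1 < m → c a i = c b i) → a = b) →
    ∑ a ∈ F, s a * ∏ i ∈ Finset.univ.filter (fun i : Fin k => i.1 < m),
      MvPolynomial.X i ^ c a i = 0 →
    ∀ a ∈ F, s a = 0 := by
  classical
  induction m with
  | zero =>
    intro F hF hsum a ha
    have h : F = {a} := by
      ext b
      rw [Finset.mem_singleton]
      exact ⟨fun hb => hF b hb a ha (by simp), fun hb => hb ▸ ha⟩
    simpa [h] using hsum
  | succ m ih =>
    intro F hF hsum a ha
    let μ : Fin k := ⟨m, hm⟩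
    have hprod : ∀ a, ∏ i ∈ Finset.univ.filter (fun i : Fin k => i.1 < m + 1),
        (MvPolynomial.X i : MvPolynomial (Fin k) ℤ) ^ c a i
        = MvPolynomial.X μ ^ c a μ * ∏ i ∈ Finset.univ.filter (fun i : Fin k => i.1 < m),
          MvPolynomial.X i ^ c a i := by
      intro a
      rw [← Finset.prod_insert (s := Finset.univ.filter fun i : Fin k => i.1 < m)
        (f := fun i => (MvPolynomial.X i : MvPolynomial (Fin k) ℤ) ^ c a i) (by simp [μ])]
      refine Finset.prod_congr ?_ fun _ _ => rfl
      ext i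
      simp only [Finset.mem_filter, Finset.mem_univ, true_and, Finset.mem_insert, μ, Fin.ext_iff]
      omega
    -- The relation is read as a polynomial in the last variable `X μ`. Swapping `μ` with any `j ≥
    -- m` fixes the symmetric coefficients and the earlier variables, so every such `X j` is a root:
    -- `k - m` distinct roots against degree at most `k - m - 1`.
    let P : (MvPolynomial (Fin k) ℤ)[X] := ∑ a ∈ F, monomial (c a μ)
      (s a * ∏ i ∈ Finset.univ.filter (fun i : Fin k => i.1 < m), MvPolynomial.X i ^ c a i)
    have heval : ∀ j : Fin k, m ≤ j.1 → P.eval (MvPolynomial.X j) = 0 := by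
      intro j hj
      have h1 := congrArg (MvPolynomial.rename (R := ℤ) (Equiv.swap μ j)) hsum
      rw [map_sum, map_zero] at h1
      rw [← h1, eval_finsetSum]
      refine Finset.sum_congr rfl fun a _ => ?_
      have h2 : ∏ i ∈ Finset.univ.filter (fun i : Fin k => i.1 < m),
          (MvPolynomial.X ((Equiv.swap μ j) i) : MvPolynomial (Fin k) ℤ) ^ c a i
          = ∏ i ∈ Finset.univ.filter (fun i : Fin k => i.1 < m), MvPolynomial.X i ^ c a i := by
        refine Finset.prod_congr rfl fun i hi => ?_
        have hi' := (Finset.mem_filter.1 hi).2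
        rw [Equiv.swap_apply_of_ne_of_ne]
        · rintro rfl
          simp [μ] at hi'
        · rintro rfl
          omega
      rw [hprod, eval_monomial, map_mul, map_mul, hs a, map_pow, map_prod,
        MvPolynomial.rename_X, Equiv.swap_apply_left]
      simp only [map_pow, MvPolynomial.rename_X]
      rw [h2]
      ring
    have hP : P = 0 := by
      refine eq_zero_of_natDegree_lt_card_of_eval_eq_zero P
        (f := fun j : {j : Fin k // m ≤ j.1} => MvPolynomial.X j.1) ?_ (fun j => heval j.1 j.2) ?_
      · intro i j hij
        exact Subtype.ext (MvPolynomial.X_injective hij)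
      · have h1 : P.natDegree ≤ k - m - 1 := by
          refine natDegree_sum_le_of_forall_le _ _ fun a _ => ?_
          refine (natDegree_monomial_le _).trans ?_
          have : c a μ + m < k := hc a μ
          omega
        have h2 : Fintype.card {j : Fin k // m ≤ j.1} = k - m := by
          rw [Fintype.card_subtype]
          have : Finset.univ.filter (fun j : Fin k => m ≤ j.1) = Finset.Ici μ := by
            ext j
            simp [μ, Fin.le_def]
          rw [this, Fin.card_Ici]
        omega
    have hcoeff := congrArg (fun p => Polynomial.coeff p (c a μ)) hP
    simp only [P, finsetSum_coeff, coeff_monomial, coeff_zero] at hcoeff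
    rw [← Finset.sum_filter] at hcoeff
    refine ih (by omega) _ ?_ hcoeff a (Finset.mem_filter.2 ⟨ha, rfl⟩)
    intro b hb b' hb' h
    rw [Finset.mem_filter] at hb hb'
    refine hF b hb.1 b' hb'.1 fun i hi => ?_
    rcases Nat.lt_succ_iff_lt_or_eq.1 hi with h1 | h1
    · exact h i h1
    · obtain rfl : i = μ := Fin.ext h1
      rw [hb.2, hb'.2]

end Staircase

/-! ### Codes of permutations -/

/-- The permutation maps the counted positions injectively to values above `i`. -/
theorem codeExp_add_lt {k : ℕ} (σ : Equiv.Perm (Fin k)) (i : Fin k) :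
    codeExp σ i + i.1 < k := by
  unfold codeExp
  have h1 : (Finset.univ.filter fun j : Fin k => j < σ⁻¹ i ∧ i < σ j).card
      ≤ (Finset.Ioi i).card := by
    rw [← Finset.card_map σ.toEmbedding]
    refine Finset.card_le_card ?_
    intro a ha
    obtain ⟨j, hj, rfl⟩ := Finset.mem_map.1 ha
    exact Finset.mem_Ioi.2 (Finset.mem_filter.1 hj).2.2
  rw [Fin.card_Ioi] at h1
  omega

theorem codeExp_injective (k : ℕ) :
    Function.Injective (codeExp : Equiv.Perm (Fin k) → Fin k → ℕ) := by
  have hinv : ∀ (σ : Equiv.Perm (Fin k)) (i : Fin k), σ⁻¹ (σ i) = i :=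
    fun σ i => σ.symm_apply_apply i
  have hinv' : ∀ (σ : Equiv.Perm (Fin k)) (i : Fin k), σ (σ⁻¹ i) = i :=
    fun σ i => σ.apply_symm_apply i
  -- At the first value `i` placed differently, all smaller values sit in the same positions. The
  -- later placement sees every larger value counted for the earlier one, and in addition whatever
  -- occupies position `σ⁻¹ i`.
  have key : ∀ (σ τ : Equiv.Perm (Fin k)) (i : Fin k), (∀ j < i, σ⁻¹ j = τ⁻¹ j) →
      σ⁻¹ i < τ⁻¹ i → codeExp σ i < codeExp τ i := by
    intro σ τ i hlt h
    have himg : ∀ j : Fin k, σ j < i → τ j = σ j := by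
      intro j hj
      have := hlt _ hj
      rw [hinv] at this
      rw [this, hinv', ← this]
    have himg' : ∀ j : Fin k, τ j < i → σ j = τ j := by
      intro j hj
      have := hlt _ hj
      rw [hinv] at this
      rw [← this, hinv', this]
    have hgt : ∀ j : Fin k, j < τ⁻¹ i → (i < τ j ↔ i ≤ σ j) := by
      intro j hj
      constructor
      · intro h1
        by_contra! h2
        rw [himg j h2] at h1
        exact absurd h1 h2.le.not_gt
      · intro h1
        by_contra! h2
        rcases h2.lt_or_eq with h3 | h3
        · rw [himg' j h3] at h1
          exact absurd h1 h3.not_ge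
        · rw [← h3, hinv] at hj
          exact lt_irrefl _ hj
    unfold codeExp
    refine Finset.card_lt_card (Finset.ssubset_iff_subset_ne.2 ⟨?_, ?_⟩)
    · intro j hj
      rw [Finset.mem_filter] at hj ⊢
      exact ⟨hj.1, hj.2.1.trans h, (hgt j (hj.2.1.trans h)).2 hj.2.2.le⟩
    · intro he
      have h1 : σ⁻¹ i ∈ Finset.univ.filter fun j : Fin k => j < τ⁻¹ i ∧ i < τ j := by
        rw [Finset.mem_filter]
        exact ⟨Finset.mem_univ _, h, (hgt _ h).2 (by simp)⟩
      rw [← he, Finset.mem_filter] at h1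
      exact lt_irrefl _ h1.2.1
  intro σ τ h
  have h1 : ∀ i, σ⁻¹ i = τ⁻¹ i := by
    intro i
    induction i using WellFoundedLT.induction with
    | ind i ih =>
      by_contra hne
      rcases lt_or_gt_of_ne hne with h2 | h2
      · exact absurd (congrFun h i) (key σ τ i ih h2).ne
      · exact absurd (congrFun h i) (key τ σ i (fun j hj => (ih j hj).symm) h2).ne'
  exact inv_injective (Equiv.ext h1)

/-- Codes inject the `k!` permutations into the `k (k - 1) ⋯ 1` staircase vectors, so every vector
occurs. -/
theorem exists_codeExp_eq {k : ℕ} (c : Fin k → ℕ) (hc : ∀ i, c i + i.1 < k) :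
    ∃ σ : Equiv.Perm (Fin k), codeExp σ = c := by
  classical
  have h : Finset.univ.image (codeExp : Equiv.Perm (Fin k) → Fin k → ℕ)
      = Fintype.piFinset fun i : Fin k => Finset.range (k - i.1) := by
    refine Finset.eq_of_subset_of_card_le ?_ ?_
    · intro c hc
      obtain ⟨σ, _, rfl⟩ := Finset.mem_image.1 hc
      rw [Fintype.mem_piFinset]
      intro i
      have := codeExp_add_lt σ i
      rw [Finset.mem_range]
      omega
    · rw [Finset.card_image_of_injective _ (codeExp_injective k), Finset.card_univ,
        Fintype.card_perm, Fintype.card_fin, Fintype.card_piFinset]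
      simp only [Finset.card_range]
      rw [Fin.prod_univ_eq_prod_range (fun i => k - i) k, ← Nat.descFactorial_eq_prod_range,
        Nat.descFactorial_self]
  have hmem : c ∈ Finset.univ.image (codeExp : Equiv.Perm (Fin k) → Fin k → ℕ) := by
    rw [h, Fintype.mem_piFinset]
    intro i
    have := hc i
    rw [Finset.mem_range]
    omega
  obtain ⟨σ, _, hσ⟩ := Finset.mem_image.1 hmem
  exact ⟨σ, hσ⟩

/-! ### The basis of Schubert monomials -/

theorem symmHom_eq_esymmAlgHom {k : ℕ} (s : MvPolynomial (Fin k) ℤ) :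
    symmHom k s = (MvPolynomial.esymmAlgHom (Fin k) ℤ k s).1 :=
  (MvPolynomial.esymmAlgHom_apply s).symm

theorem symmHom_isSymmetric {k : ℕ} (s : S k) : (symmHom k s).IsSymmetric := by
  exact (congrArg MvPolynomial.IsSymmetric (symmHom_eq_esymmAlgHom s)).mpr
    (MvPolynomial.esymmAlgHom (Fin k) ℤ k s).2

theorem symmHom_injective (k : ℕ) : Function.Injective (symmHom k) := by
  intro s s' h
  exact (MvPolynomial.esymmAlgHom_fin_bijective ℤ k).1 (Subtype.ext
    ((symmHom_eq_esymmAlgHom s).symm.trans (h.trans (symmHom_eq_esymmAlgHom s'))))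

theorem exists_symmHom_eq {k : ℕ} {p : MvPolynomial (Fin k) ℤ} (hp : p.IsSymmetric) :
    ∃ s, symmHom k s = p := by
  obtain ⟨s, hs⟩ := (MvPolynomial.esymmAlgHom_fin_bijective ℤ k).2 ⟨p, hp⟩
  exact ⟨s, (symmHom_eq_esymmAlgHom s).trans (congrArg Subtype.val hs)⟩

theorem schubertMonomial_independent {k : ℕ} (s : Equiv.Perm (Fin k) → S k)
    (h : ∑ σ, symmHom k (s σ) * schubertMonomial σ = 0) (σ : Equiv.Perm (Fin k)) : s σ = 0 := by
  refine symmHom_injective k ?_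
  rw [map_zero]
  refine staircase_independent codeExp codeExp_add_lt (fun σ => symmHom k (s σ))
    (fun σ => symmHom_isSymmetric _) k le_rfl Finset.univ ?_ ?_ σ (Finset.mem_univ σ)
  · intro σ _ τ _ h
    exact codeExp_injective k (funext fun i => h i i.2)
  · rw [← h]
    refine Finset.sum_congr rfl fun σ _ => ?_
    congr 1
    unfold schubertMonomial
    refine Finset.prod_congr ?_ fun _ _ => rfl
    ext i
    simp

open Polynomial in
-- The coefficients of `∏ (X - X_i)` are symmetric, so this polynomial lifts to a monic polynomial
-- over `S`, and the staircase spanning theorem applies to its roots.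
theorem exists_schubertMonomial_sum {k : ℕ} (p : MvPolynomial (Fin k) ℤ) :
    ∃ s : Equiv.Perm (Fin k) → S k, p = ∑ σ, symmHom k (s σ) * schubertMonomial σ := by
  let _ : Algebra (S k) (MvPolynomial (Fin k) ℤ) := (symmHom k).toAlgebra
  have hlift : ∏ i : Fin k, (X - Polynomial.C (MvPolynomial.X i : MvPolynomial (Fin k) ℤ))
      ∈ Polynomial.lifts (algebraMap (S k) (MvPolynomial (Fin k) ℤ)) := by
    rw [Polynomial.lifts_iff_coeff_lifts]
    intro m
    refine exists_symmHom_eq fun e => ?_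
    have h : (∏ i : Fin k, (X - Polynomial.C (MvPolynomial.X i : MvPolynomial (Fin k) ℤ))).map
        (MvPolynomial.rename (R := ℤ) e : _ →+* _)
        = ∏ i : Fin k, (X - Polynomial.C (MvPolynomial.X i : MvPolynomial (Fin k) ℤ)) := by
      rw [Polynomial.map_prod]
      simp only [Polynomial.map_sub, Polynomial.map_X, Polynomial.map_C, RingHom.coe_coe,
        MvPolynomial.rename_X]
      exact Equiv.prod_comp e fun i => X - Polynomial.C (MvPolynomial.X i : MvPolynomial (Fin k) ℤ)
    have h1 := congrArg (fun q => Polynomial.coeff q m) h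
    simpa [Polynomial.coeff_map] using h1
  obtain ⟨P, hP, -, hPm⟩ := Polynomial.lifts_and_natDegree_eq_and_monic hlift
    (Polynomial.monic_prod_of_monic _ _ fun i _ => Polynomial.monic_X_sub_C _)
  have hgen : Algebra.adjoin (S k)
      (Set.range (MvPolynomial.X : Fin k → MvPolynomial (Fin k) ℤ)) = ⊤ := by
    rw [eq_top_iff]
    rintro q -
    induction q using MvPolynomial.induction_on with
    | C a =>
      rw [show (MvPolynomial.C a : MvPolynomial (Fin k) ℤ) = ((a : ℤ) : MvPolynomial (Fin k) ℤ) by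
        simp]
      exact intCast_mem _ a
    | add p q hp hq => exact add_mem hp hq
    | mul_X p i hp => exact mul_mem hp (Algebra.subset_adjoin ⟨i, rfl⟩)
  have h1 := span_staircase_eq_top k (S k) (MvPolynomial (Fin k) ℤ) MvPolynomial.X P hPm hP hgen
  have h2 : {x : MvPolynomial (Fin k) ℤ | ∃ c : Fin k → ℕ, (∀ i, c i + i.1 < k) ∧
      x = ∏ i, MvPolynomial.X i ^ c i} ⊆ Set.range schubertMonomial := by
    rintro _ ⟨c, hc, rfl⟩
    obtain ⟨σ, rfl⟩ := exists_codeExp_eq c hc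
    exact ⟨σ, rfl⟩
  have h3 : p ∈ Submodule.span (S k) (Set.range (schubertMonomial (k := k))) :=
    Submodule.span_mono h2 (h1 ▸ Submodule.mem_top)
  obtain ⟨s, hs⟩ := (Submodule.mem_span_range_iff_exists_fun (S k)).1 h3
  exact ⟨s, hs.symm⟩

/-! ### Generation by arrows -/


/-- The inclusion of `B_l(n,k)` into `B(n,k)` as a linear map. -/
noncomputable def Bl.valLinear (n k : ℕ) : Bl n k →ₗ[PolyU n] B n k where
  toFun := Bl.val
  map_add' := Bl.val_add
  map_smul' := Bl.val_smul

theorem Bl.val_fl (x y : Vl n k) : (fl x y).val = f x.toV y.toV := rfl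

theorem S_smul_eq (s : S k) (a : Bl n k) : s • a = epsHom n k s • a := rfl

theorem sum_f_self : ∑ x : V n k, f x x = 1 := by
  have h : mkB n k (mkB0 n k (∑ x : V n k, arrow x x)) = mkB n k (mkB0 n k 1) :=
    congrArg _ (RingQuot.mkAlgHom_rel _ B0Rel.one)
  rw [map_sum, map_sum, map_one, map_one] at h
  exact h

/-- The `ℤ[U_1, …, U_n]`-submodule of `B(n,k)` spanned by the arrows. -/
noncomputable def arrowSpan (n k : ℕ) : Submodule (PolyU n) (B n k) :=
  Submodule.span (PolyU n) (Set.range fun p : V n k × V n k => f p.1 p.2)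

theorem f_mem_arrowSpan (x y : V n k) : f x y ∈ arrowSpan n k :=
  Submodule.subset_span ⟨(x, y), rfl⟩

theorem mul_mem_arrowSpan {a b : B n k} (ha : a ∈ arrowSpan n k) (hb : b ∈ arrowSpan n k) :
    a * b ∈ arrowSpan n k := by
  induction ha, hb using Submodule.span_induction₂ with
  | mem_mem a b ha hb =>
    obtain ⟨⟨x, y⟩, rfl⟩ := ha
    obtain ⟨⟨z, w⟩, rfl⟩ := hb
    by_cases h : y = z
    · subst h
      simp only [f_mul_f]
      exact Submodule.smul_mem _ _ (f_mem_arrowSpan x w)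
    · simp only [f_mul_f_of_ne _ _ _ _ h]
      exact Submodule.zero_mem _
  | zero_left b hb => rw [zero_mul]; exact Submodule.zero_mem _
  | zero_right a ha => rw [mul_zero]; exact Submodule.zero_mem _
  | add_left a a' b _ _ _ h h' => rw [add_mul]; exact Submodule.add_mem _ h h'
  | add_right a b b' _ _ _ h h' => rw [mul_add]; exact Submodule.add_mem _ h h'
  | smul_left r a b _ _ h => rw [smul_mul_assoc]; exact Submodule.smul_mem _ _ h
  | smul_right r a b _ _ h => rw [mul_smul_comm]; exact Submodule.smul_mem _ _ h

theorem mem_arrowSpan (b : B n k) : b ∈ arrowSpan n k := by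
  obtain ⟨b, rfl⟩ := RingQuot.mkAlgHom_surjective (PolyU n) (BRel n k) b
  obtain ⟨a, rfl⟩ := RingQuot.mkAlgHom_surjective (PolyU n) (B0Rel n k) b
  change mkB n k (mkB0 n k a) ∈ arrowSpan n k
  induction a using FreeAlgebra.induction with
  | grade0 r =>
    rw [AlgHom.commutes, AlgHom.commutes, Algebra.algebraMap_eq_smul_one, ← sum_f_self]
    exact Submodule.smul_mem _ _ (Submodule.sum_mem _ fun x _ => f_mem_arrowSpan x x)
  | grade1 p => exact f_mem_arrowSpan p.1 p.2
  | mul a b ha hb =>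
    rw [map_mul, map_mul]
    exact mul_mem_arrowSpan ha hb
  | add a b ha hb =>
    rw [map_add, map_add]
    exact Submodule.add_mem _ ha hb

theorem leftIdem_mul_f_of_ne {x : V n k} (hx : ∀ x' : Vl n k, x'.toV ≠ x) (y : V n k) :
    leftIdem n k * f x y = 0 := by
  unfold leftIdem
  rw [Finset.sum_mul]
  exact Finset.sum_eq_zero fun x' _ => f_mul_f_of_ne _ _ _ _ (hx x')

theorem f_mul_leftIdem_of_ne (x : V n k) {y : V n k} (hy : ∀ y' : Vl n k, y'.toV ≠ y) :
    f x y * leftIdem n k = 0 := by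
  unfold leftIdem
  rw [Finset.mul_sum]
  exact Finset.sum_eq_zero fun y' _ => f_mul_f_of_ne _ _ _ _ (hy y').symm

theorem mem_span_fl (a : Bl n k) :
    a ∈ Submodule.span (PolyU n) (Set.range fun p : Vl n k × Vl n k => fl p.1 p.2) := by
  have key : ∀ b ∈ arrowSpan n k, ∃ c ∈ Submodule.span (PolyU n)
      (Set.range fun p : Vl n k × Vl n k => fl p.1 p.2),
      Bl.val c = leftIdem n k * b * leftIdem n k := by
    intro b hb
    induction hb using Submodule.span_induction with
    | mem b hb =>
      obtain ⟨⟨x, y⟩, rfl⟩ := hb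
      simp only
      by_cases hx : ∃ x' : Vl n k, x'.toV = x
      · by_cases hy : ∃ y' : Vl n k, y'.toV = y
        · obtain ⟨x', rfl⟩ := hx
          obtain ⟨y', rfl⟩ := hy
          refine ⟨fl x' y', Submodule.subset_span ⟨(x', y'), rfl⟩, ?_⟩
          rw [leftIdem_mul_f, f_mul_leftIdem, Bl.val_fl]
        · push Not at hy
          exact ⟨0, Submodule.zero_mem _, by
            rw [mul_assoc, f_mul_leftIdem_of_ne _ hy, mul_zero, Bl.val_zero]⟩
      · push Not at hx
        exact ⟨0, Submodule.zero_mem _, by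
          rw [leftIdem_mul_f_of_ne hx, zero_mul, Bl.val_zero]⟩
    | zero => exact ⟨0, Submodule.zero_mem _, by rw [mul_zero, zero_mul, Bl.val_zero]⟩
    | add b b' _ _ h h' =>
      obtain ⟨c, hc, hcv⟩ := h
      obtain ⟨c', hc', hcv'⟩ := h'
      exact ⟨c + c', Submodule.add_mem _ hc hc', by
        rw [Bl.val_add, hcv, hcv', mul_add, add_mul]⟩
    | smul r b _ h =>
      obtain ⟨c, hc, hcv⟩ := h
      exact ⟨r • c, Submodule.smul_mem _ _ hc, by
        rw [Bl.val_smul, hcv, mul_smul_comm, smul_mul_assoc]⟩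
  obtain ⟨b, hb⟩ := a.2
  obtain ⟨c, hc, hcv⟩ := key b (mem_arrowSpan b)
  have h : c = a := Bl.val_injective (hcv.trans hb)
  rwa [← h]

/-! ### Independence of the fork elements -/

theorem schubertAt_eq_extendFrom (z : Vl n k) (σ : Equiv.Perm (Fin k)) :
    schubertAt z σ = extendFrom z (schubertMonomial σ) := rfl

theorem restrictTo_schubertAt (z : Vl n k) (σ : Equiv.Perm (Fin k)) :
    restrictTo z (schubertAt z σ) = schubertMonomial σ := by
  rw [schubertAt_eq_extendFrom, restrictTo_extendFrom]

theorem restrictTo_baseMonomial_ne_zero {x y z : Vl n k} (hx : Near z.1 x.1) :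
    restrictTo z (baseMonomial x y z) ≠ 0 := by
  unfold baseMonomial
  rw [map_prod, Finset.prod_ne_zero_iff]
  intro t _
  rw [map_pow]
  by_cases ht : t.1 ∈ z.1
  · obtain ⟨i, rfl⟩ := (mem_range_nthEmb z t).2 ht
    rw [restrictTo_X_nthEmb]
    exact pow_ne_zero _ (MvPolynomial.X_ne_zero i)
  · have h1 := hx t.1 ht
    rw [show min (weight x.1 (t.1 + 1)) (weight y.1 (t.1 + 1)) - weight z.1 (t.1 + 1) = 0 by omega,
      pow_zero]
    exact one_ne_zero

/-- At a hole of `z` the exponent `min(v^x, v^y) - v^w` must vanish, so `v^z ≤ v^w` there; the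
reverse inequality is `v^w ≤ v^x = v^z`. -/
theorem near_of_restrictTo_baseMonomial_ne_zero {x y z w : Vl n k} (hx : Near z.1 x.1)
    (hy : Near z.1 y.1) (hw : Near w.1 x.1) (h : restrictTo z (baseMonomial x y w) ≠ 0) :
    Near z.1 w.1 := by
  intro t ht
  have h1 := hx t ht
  have h2 := hy t ht
  have h3 := hw.le (x.card_eq.trans w.card_eq.symm) (t + 1)
  by_cases htn : t < n
  · unfold baseMonomial at h
    rw [map_prod, Finset.prod_ne_zero_iff] at h
    have h4 := h ⟨t, htn⟩ (Finset.mem_univ _)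
    rw [map_pow, restrictTo_X_of_notMem z ht] at h4
    have h5 : min (weight x.1 (t + 1)) (weight y.1 (t + 1)) - weight w.1 (t + 1) = 0 := by
      by_contra h6
      exact h4 (zero_pow h6)
    omega
  · rw [w.weight_eq_zero (by omega), z.weight_eq_zero (by omega)]

/-- The sum of the weights of a left state. -/
def totalWeight (z : Vl n k) : ℕ := ∑ m ∈ Finset.range (n + 1), weight z.1 m

theorem totalWeight_le (z : Vl n k) : totalWeight z ≤ (n + 1) * k := by
  unfold totalWeight
  refine (Finset.sum_le_card_nsmul _ _ k fun m _ => ?_).trans (by simp)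
  exact (Finset.card_filter_le _ _).trans z.card_eq.le

theorem totalWeight_lt {z w : Vl n k} (h : ∀ m, weight z.1 m ≤ weight w.1 m) (hne : z ≠ w) :
    totalWeight z < totalWeight w := by
  have h1 : ∃ m, weight z.1 m < weight w.1 m := by
    by_contra! h2
    exact hne (Subtype.ext (eq_of_weight_eq fun m => (h m).antisymm (h2 m)))
  obtain ⟨m, hm⟩ := h1
  refine Finset.sum_lt_sum (fun m _ => h m) ⟨m, Finset.mem_range.2 ?_, hm⟩
  by_contra! h2
  rw [w.weight_eq_zero (by omega)] at hm
  omega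

instance : Finite (ForkIndex n k) := by
  refine Finite.of_injective
    (β := Vl n k × Vl n k × Vl n k × Equiv.Perm (Fin k))
    (fun q => (q.x, q.z, q.y, q.σ)) ?_
  intro q q' h
  simp only [Prod.mk.injEq] at h
  exact ForkIndex.ext h.1 h.2.1 h.2.2.1 h.2.2.2

theorem linearIndependent_forkElement :
    LinearIndependent (S k) (forkElement : ForkIndex n k → Bl n k) := by
  classical
  let _ : Fintype (ForkIndex n k) := Fintype.ofFinite _
  rw [Fintype.linearIndependent_iff]
  intro g hg q
  -- Coefficients are shown to vanish in order of decreasing total weight of `z`.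
  induction hN : (n + 1) * k - totalWeight q.z using Nat.strong_induction_on generalizing q with
  | _ N ih =>
  have hx : Near q.z.1 q.x.toV.1 := q.near_x
  have hy : Near q.z.1 q.y.toV.1 := q.near_y
  obtain ⟨Λ, hΛ⟩ := exists_coefficient q.z hx hy
  have h1 := congrArg (fun a => Λ (Bl.valLinear n k a)) hg
  simp only [map_sum, map_zero] at h1
  have h2 : ∀ p : ForkIndex n k, Λ (Bl.valLinear n k (g p • forkElement p))
      = Ideal.Quotient.mk (RingHom.ker (restrictTo q.z)) (if p.x = q.x ∧ p.y = q.y then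
        epsHom n k (g p) * (schubertAt p.z p.σ * baseMonomial p.x p.y p.z) else 0) := by
    intro p
    rw [S_smul_eq, forkElement_eq, smul_smul, map_smul, map_smul]
    change _ • Λ (f p.x.toV p.y.toV) = _
    rw [hΛ]
    simp only [toV_injective.eq_iff]
    split_ifs with h
    · rw [Algebra.smul_def, mul_one]
      rfl
    · rw [smul_zero, map_zero]
  simp only [h2] at h1
  rw [← map_sum, Ideal.Quotient.eq_zero_iff_mem, RingHom.mem_ker, map_sum] at h1
  -- Only forks with the same `x`, `y`, `z` survive: other endpoints are not seen by `Λ`, and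
  -- another `z` either has base monomial zero modulo the holes or has larger total weight, so its
  -- coefficient is zero by induction.
  have h3 : ∑ σ, symmHom k (g (.ofNear q.x q.y q.z σ q.near_x q.near_y)) * schubertMonomial σ
      * restrictTo q.z (baseMonomial q.x q.y q.z) = 0 := by
    rw [← h1]
    refine Finset.sum_of_injOn
      (fun σ => ForkIndex.ofNear q.x q.y q.z σ q.near_x q.near_y) ?_ ?_ ?_ ?_
    · intro σ _ τ _ h
      exact congrArg ForkIndex.σ h
    · intro σ _
      exact Finset.mem_coe.2 (Finset.mem_univ _)
    · intro p _ hp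
      split_ifs with hpq
      · obtain ⟨hpx, hpy⟩ := hpq
        have hz : p.z ≠ q.z := by
          intro hz
          refine hp ⟨p.σ, Finset.mem_coe.2 (Finset.mem_univ _), ?_⟩
          exact ForkIndex.ext hpx.symm hz.symm hpy.symm rfl
        by_cases h : restrictTo q.z (baseMonomial p.x p.y p.z) = 0
        · rw [map_mul, map_mul, h, mul_zero, mul_zero]
        · rw [hpx, hpy] at h
          have h4 := near_of_restrictTo_baseMonomial_ne_zero q.near_x q.near_y (hpx ▸ p.near_x) h
          have h5 := totalWeight_lt (h4.le (p.z.card_eq.trans q.z.card_eq.symm)) hz.symm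
          have h6 := totalWeight_le p.z
          rw [ih _ (by omega) p rfl, map_zero, zero_mul, map_zero]
      · exact map_zero _
    · intro σ _
      rw [if_pos ⟨rfl, rfl⟩, map_mul, map_mul, restrictTo_epsHom, ← mul_assoc]
      congr 2
      exact (restrictTo_schubertAt q.z σ).symm
  rw [← Finset.sum_mul] at h3
  have h4 := (mul_eq_zero.1 h3).resolve_right (restrictTo_baseMonomial_ne_zero q.near_x)
  exact schubertMonomial_independent _ h4 q.σ

/-! ### Generation by the fork elements -/

theorem baseMonomial_eq_one {x y z : Vl n k}
    (h : ∀ m, weight z.1 m = min (weight x.1 m) (weight y.1 m)) : baseMonomial x y z = 1 := by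
  unfold baseMonomial
  refine Finset.prod_eq_one fun t _ => ?_
  rw [h, Nat.sub_self, pow_zero]

theorem exists_near_of_not_tooFar {x y : Vl n k} (h : ¬ TooFar k x.1 y.1) :
    ∃ z : Vl n k, Near z.1 x.1 ∧ Near z.1 y.1 ∧ baseMonomial x y z = 1 := by
  obtain ⟨z, hz⟩ := Vl.exists_weight_eq (n := n) (k := k)
    (fun m => min (weight x.1 m) (weight y.1 m))
    (by simp [x.weight_zero, y.weight_zero]) (by simp [x.weight_eq_zero le_rfl])
    (fun m => by
      have := weight_succ_le x.1 m
      have := weight_le_succ x.1 m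
      have := weight_succ_le y.1 m
      have := weight_le_succ y.1 m
      omega)
  rw [not_tooFar_iff_weight x.card_eq y.card_eq] at h
  refine ⟨z, ?_, ?_, baseMonomial_eq_one hz⟩
  · rw [near_iff_weight (x.card_eq.trans z.card_eq.symm)]
    intro m
    have := h m
    have := weight_succ_le x.1 m
    rw [hz]
    omega
  · rw [near_iff_weight (y.card_eq.trans z.card_eq.symm)]
    intro m
    have := h m
    have := weight_succ_le y.1 m
    rw [hz]
    omega

/-- The state `w` is `z` with its particle at `t + 1` moved to the hole `t`. This lowers the weight
on line `t + 1` alone, which adds one factor `U_{t+1}`. -/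
theorem exists_near_of_mem {x y z : Vl n k} (hx : Near z.1 x.1) (hy : Near z.1 y.1) {t : Fin n}
    (ht : t.1 ∉ z.1) (htx : t.1 + 1 ∈ x.1) (hty : t.1 + 1 ∈ y.1) :
    ∃ w : Vl n k, Near w.1 x.1 ∧ Near w.1 y.1 ∧ totalWeight w < totalWeight z ∧
      baseMonomial x y w = MvPolynomial.X t * baseMonomial x y z := by
  have hxc := x.card_eq.trans z.card_eq.symm
  have hyc := y.card_eq.trans z.card_eq.symm
  have h1 := hx t.1 ht
  have h2 := hy t.1 ht
  have h3 : weight x.1 (t.1 + 1) = weight x.1 (t.1 + 2) + 1 := weight_of_mem htx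
  have h4 : weight y.1 (t.1 + 1) = weight y.1 (t.1 + 2) + 1 := weight_of_mem hty
  have h5 := hx.le hxc (t.1 + 2)
  have h6 : weight z.1 (t.1 + 1) ≤ weight z.1 (t.1 + 2) + 1 := weight_le_succ _ _
  have h7 := weight_of_notMem ht
  obtain ⟨w, hw⟩ := Vl.exists_weight_eq (n := n) (k := k)
    (fun m => weight z.1 m - if m = t.1 + 1 then 1 else 0)
    (by simp [z.weight_zero]) (by simp [z.weight_eq_zero le_rfl])
    (fun m => by
      have := weight_succ_le z.1 m
      have := weight_le_succ z.1 m
      rcases eq_or_ne m t.1 with rfl | h8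
      · simp
        omega
      · rcases eq_or_ne m (t.1 + 1) with rfl | h9
        · simp only [add_assoc, Nat.reduceAdd] at *
          simp
          omega
        · simp only [h9, show ¬ m + 1 = t.1 + 1 by omega, if_false]
          omega)
  have hle : ∀ m, weight w.1 m ≤ weight z.1 m := fun m => by
    rw [hw]
    exact Nat.sub_le _ _
  have hnear : ∀ u : Vl n k, Near z.1 u.1 → t.1 + 1 ∈ u.1 → Near w.1 u.1 := by
    intro u hu htu
    have huc := u.card_eq.trans z.card_eq.symm
    rw [near_iff_weight (u.card_eq.trans w.card_eq.symm)]
    intro m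
    have h8 := (near_iff_weight huc).1 hu m
    refine ⟨(hle m).trans h8.1, ?_⟩
    rw [hw]
    split_ifs with h9
    · subst h9
      have := weight_of_mem htu
      have := hu t.1 ht
      omega
    · exact h8.2
  refine ⟨w, hnear x hx htx, hnear y hy hty, totalWeight_lt hle ?_, ?_⟩
  · rintro rfl
    have := hw (t.1 + 1)
    rw [if_pos rfl] at this
    omega
  · unfold baseMonomial
    have h8 : (MvPolynomial.X t : PolyU n)
        = ∏ s : Fin n, MvPolynomial.X s ^ (if s = t then 1 else 0) := by
      simp [pow_ite]
    rw [h8, ← Finset.prod_mul_distrib]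
    refine Finset.prod_congr rfl fun s _ => ?_
    rw [← pow_add]
    congr 1
    rw [hw]
    by_cases h9 : s = t
    · subst h9
      simp only [if_true]
      omega
    · have h10 : ¬ s.1 + 1 = t.1 + 1 := fun h => h9 (Fin.ext (by omega))
      simp only [h9, h10, if_false]
      omega

/-- Follow the factors of the base monomial leftwards from `U_t` for as long as they occur. Together
with `U_{t+1}` they fill a generating interval of `x`, `y`, whose product annihilates the arrow. -/
theorem X_mul_baseMonomial_smul_fl {x y z : Vl n k} (hx : Near z.1 x.1) (hy : Near z.1 y.1)
    {t : Fin n} (ht : t.1 ∉ z.1) (hxy : t.1 + 1 ∉ x.1 ∩ y.1) :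
    (MvPolynomial.X t * baseMonomial x y z) • fl x y = 0 := by
  classical
  have hxc := x.card_eq.trans z.card_eq.symm
  have hyc := y.card_eq.trans z.card_eq.symm
  -- The least such `j` is the start of the interval: `U_{j+1}, …, U_t` divide the base monomial,
  -- and for `j > 0` minimality says that `U_j` does not.
  have hex : ∃ j, j ≤ t.1 ∧ ∀ r, j ≤ r → r < t.1 →
      weight z.1 (r + 1) < min (weight x.1 (r + 1)) (weight y.1 (r + 1)) :=
    ⟨t.1, le_rfl, fun r h1 h2 => by omega⟩
  obtain ⟨hj, hlt⟩ := Nat.find_spec hex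
  have hmin := fun m => Nat.find_min hex (m := m)
  generalize Nat.find hex = j at hj hlt hmin
  have hpred : ∀ i, j = i + 1 →
      min (weight x.1 j) (weight y.1 j) ≤ weight z.1 j := by
    rintro i rfl
    by_contra! h
    refine hmin i (by omega) ⟨by omega, fun r h1 h2 => ?_⟩
    rcases eq_or_ne r i with rfl | h3
    · exact h
    · exact hlt r (by omega) h2
  have hw1 : ∀ r, j ≤ r → r < t.1 → weight x.1 (r + 1) = weight z.1 (r + 1) + 1 ∧
      weight y.1 (r + 1) = weight z.1 (r + 1) + 1 ∧ r ∈ z.1 := by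
    intro r h1 h2
    have h3 := hlt r h1 h2
    have h4 := hx.le_succ (r + 1)
    have h5 := hy.le_succ (r + 1)
    refine ⟨by omega, by omega, ?_⟩
    by_contra h6
    have := hx r h6
    omega
  have ht1 := hx t.1 ht
  have ht2 := hy t.1 ht
  have hdvd : (∏ s ∈ Finset.univ.filter (fun s : Fin n => j ≤ s.1 ∧ s.1 ≤ t.1),
      (MvPolynomial.X s : PolyU n)) ∣ MvPolynomial.X t * baseMonomial x y z := by
    have h2 : Finset.univ.filter (fun s : Fin n => j ≤ s.1 ∧ s.1 ≤ t.1)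
        = insert t (Finset.univ.filter (fun s : Fin n => j ≤ s.1 ∧ s.1 < t.1)) := by
      ext s
      simp only [Finset.mem_filter, Finset.mem_univ, true_and, Finset.mem_insert, Fin.ext_iff]
      omega
    rw [h2, Finset.prod_insert (by simp)]
    refine mul_dvd_mul_left _ ?_
    unfold baseMonomial
    rw [Finset.prod_filter]
    refine Finset.prod_dvd_prod_of_dvd _ _ fun s _ => ?_
    split_ifs with h3
    · have := hlt s.1 h3.1 h3.2
      exact dvd_pow_self _ (by omega)
    · exact one_dvd _
  obtain ⟨c, hc⟩ := hdvd
  refine Bl.val_injective ?_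
  rw [Bl.val_smul, Bl.val_fl, Bl.val_zero, hc, mul_comm, mul_smul,
    prod_X_smul_f (x := x.toV) (y := y.toV) t hj, smul_zero]
  · change j ∉ x.1 ∩ y.1
    intro hjxy
    rw [Finset.mem_inter, mem_iff_weight, mem_iff_weight] at hjxy
    -- If `j` were fully used, both weights would exceed that of `z` on line `j` too. This
    -- contradicts minimality, or the common weight `k` on line `0`.
    have h3 : weight x.1 j = weight z.1 j + 1 ∧ weight y.1 j = weight z.1 j + 1 := by
      rcases hj.lt_or_eq with h | h
      · have h4 := hw1 j le_rfl h
        have h5 := weight_of_mem h4.2.2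
        omega
      · rw [← h] at ht ht1 ht2
        have h5 := weight_of_notMem ht
        omega
    rcases Nat.eq_zero_or_eq_succ_pred j with h | h
    · rw [h, x.weight_zero, z.weight_zero] at h3
      omega
    · have := hpred _ h
      omega
  · exact hxy
  · intro r h1 h2
    change r ∈ x.1 ∩ y.1
    obtain ⟨i, rfl⟩ : ∃ i, r = i + 1 := ⟨r - 1, by omega⟩
    have h3 := hw1 i (by omega) (by omega)
    rw [Finset.mem_inter, mem_iff_weight, mem_iff_weight]
    rcases h2.lt_or_eq with h4 | h4
    · have h5 := hw1 (i + 1) (by omega) h4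
      have h6 := weight_of_mem h5.2.2
      omega
    · rw [← h4] at ht ht1 ht2
      have h5 := weight_of_notMem ht
      omega
  · intro m h1 h2
    change weight x.1 m = weight y.1 m
    obtain ⟨i, rfl⟩ : ∃ i, m = i + 1 := ⟨m - 1, by omega⟩
    rcases (show i ≤ t.1 by omega).lt_or_eq with h4 | h4
    · have h5 := hw1 i (by omega) h4
      omega
    · rw [h4]
      omega

theorem mul_baseMonomial_smul_fl_mem {x y : Vl n k} (z : Vl n k) (hx : Near z.1 x.1)
    (hy : Near z.1 y.1) (p : PolyU n) : (p * baseMonomial x y z) • fl x y ∈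
      Submodule.span (S k) (Set.range (forkElement : ForkIndex n k → Bl n k)) := by
  induction hN : totalWeight z using Nat.strong_induction_on generalizing z p with
  | _ N ih =>
  have hideal : ∀ r : PolyU n, restrictTo z r = 0 → (r * baseMonomial x y z) • fl x y ∈
      Submodule.span (S k) (Set.range (forkElement : ForkIndex n k → Bl n k)) := by
    intro r hr
    have hr' := mem_span_of_restrictTo_eq_zero z hr
    clear hr
    rw [← one_mul r]
    -- A free multiplier `a` absorbs the coefficients that arise in the induction over the ideal.
    generalize (1 : PolyU n) = a
    induction hr' using Submodule.span_induction generalizing a with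
    | mem r h =>
      obtain ⟨t, ht, rfl⟩ := h
      by_cases hxy : t.1 + 1 ∈ x.1 ∩ y.1
      · obtain ⟨htx, hty⟩ := Finset.mem_inter.1 hxy
        obtain ⟨w, hwx, hwy, hlt, hw⟩ := exists_near_of_mem hx hy ht htx hty
        rw [mul_assoc, ← hw]
        exact ih _ (hN ▸ hlt) w hwx hwy a rfl
      · rw [mul_assoc, mul_smul, X_mul_baseMonomial_smul_fl hx hy ht hxy, smul_zero]
        exact Submodule.zero_mem _
    | zero =>
      rw [mul_zero, zero_mul, zero_smul]
      exact Submodule.zero_mem _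
    | add r r' _ _ h h' =>
      rw [mul_add, add_mul, add_smul]
      exact Submodule.add_mem _ (h a) (h' a)
    | smul b r _ h =>
      rw [smul_eq_mul, ← mul_assoc]
      exact h (a * b)
  obtain ⟨s, hs⟩ := exists_schubertMonomial_sum (restrictTo z p)
  -- The second summand has the same restriction to `z` as `p`, so the difference lies in the ideal
  -- of the variables at holes of `z`.
  have hp : p = (p - ∑ σ, epsHom n k (s σ) * schubertAt z σ)
      + ∑ σ, epsHom n k (s σ) * schubertAt z σ := by ring
  rw [hp, add_mul, add_smul]
  refine Submodule.add_mem _ (hideal _ ?_) ?_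
  · rw [map_sub, map_sum, sub_eq_zero, hs]
    refine Finset.sum_congr rfl fun σ _ => ?_
    rw [map_mul, restrictTo_epsHom, restrictTo_schubertAt]
  · rw [Finset.sum_mul, Finset.sum_smul]
    refine Submodule.sum_mem _ fun σ _ => ?_
    have h : (epsHom n k (s σ) * schubertAt z σ * baseMonomial x y z) • fl x y
        = s σ • forkElement (ForkIndex.ofNear x y z σ hx hy) := by
      rw [S_smul_eq, forkElement_eq, smul_smul, mul_assoc]
      rfl
    rw [h]
    exact Submodule.smul_mem _ _ (Submodule.subset_span ⟨_, rfl⟩)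

theorem smul_fl_mem (p : PolyU n) (x y : Vl n k) : p • fl x y ∈
    Submodule.span (S k) (Set.range (forkElement : ForkIndex n k → Bl n k)) := by
  by_cases h : TooFar k x.1 y.1
  · have h1 : fl x y = 0 := Bl.val_injective
      (f_eq_zero_of_tooFar (x := x.toV) (y := y.toV) h)
    rw [h1, smul_zero]
    exact Submodule.zero_mem _
  · obtain ⟨z, hx, hy, hz⟩ := exists_near_of_not_tooFar h
    have h1 := mul_baseMonomial_smul_fl_mem z hx hy p
    rwa [hz, mul_one] at h1

theorem span_forkElement :
    ⊤ ≤ Submodule.span (S k) (Set.range (forkElement : ForkIndex n k → Bl n k)) := by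
  rintro a -
  obtain ⟨c, rfl⟩ := (Submodule.mem_span_range_iff_exists_fun (PolyU n)).1 (mem_span_fl a)
  exact Submodule.sum_mem _ fun p _ => smul_fl_mem _ _ _

end OzsvathSzabo

theorem mainTheorem2 (n k : ℕ) (hk : k ≤ n) :
    Module.Free (OzsvathSzabo.S k) (OzsvathSzabo.Bl n k) ∧
      ∃ b : Module.Basis (OzsvathSzabo.ForkIndex n k) (OzsvathSzabo.S k) (OzsvathSzabo.Bl n k),
        ∀ q : OzsvathSzabo.ForkIndex n k, b q = OzsvathSzabo.forkElement q := by
  let b := Module.Basis.mk (OzsvathSzabo.linearIndependent_forkElement (n := n) (k := k))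
    OzsvathSzabo.span_forkElement
  exact ⟨Module.Free.of_basis b, b, fun q => Module.Basis.mk_apply _ _ q⟩
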